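/- Let $U\subseteq\mathbb{R}^3$ be open and $f:U\to\mathbb{R}$ smooth. Write $f_i=\nabla_if$, $f_{ij}=\nabla_i\nabla_jf$, $f_{ijk}=\nabla_i\nabla_j\nabla_kf$ for the partial derivatives of $f$; indices are raised and lowered with the flat metric $g_{ij}=\delta_{ij}$, repeated indices are summed, round brackets denote symmetrisation (with the factor $1/n!$ for $n$ indices), and $\epsilon^{ijk}$ is the alternating symbol with $\epsilon^{123}=1$. Set $$J=f^if_i,\qquad Z=f^{ij}f_if_j+Jf^j{}_j,\qquad X=2f_i{}^jf_jf^{ik}f_k-Jf^{jk}f_{jk}+J(f^j{}_j)^2,\qquad Y=Z^2-2JX,$$ $$\sigma_i=J\nabla_iZ-2Z\nabla_iJ,\qquad \phi_{ij}=Jf_{ij}-2f_{(i}f_{j)}{}^kf_k-\tfrac13Jf^k{}_kg_{ij}+\tfrac23f^{kl}f_kf_lg_{ij},$$ $$\rho_{ijk}=J\nabla_{(i}\phi_{jk)}-3\phi_{(ij}\nabla_{k)}J-\tfrac25Jg_{(ij}\nabla^l\phi_{k)l}+\tfrac65g_{(ij}\phi_{k)l}\nabla^lJ,\qquad \lambda_j=2J\nabla^i\phi_{ij}-\phi_{ij}\nabla^iJ,$$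 $$A=\sigma^i\sigma_i,\quad T=\phi^{ij}\sigma_i\sigma_j,\quad F=\rho^{ijk}\phi_{ij}\lambda_k,\quad G=\phi^{ij}\lambda_i\lambda_j,\quad K=\sigma^i\lambda_i,\quad N=\sigma_i\rho^{ijk}\phi_{jk},$$ $$Q^{ij}=f^{ijk}f_k-2f^{ik}f_k{}^j,\qquad V=4J\,\epsilon^{jkl}\bigl(Jf_k{}^iQ_{ij}-f^iQ_{ij}f_{km}f^m\bigr)f_l .$$ Suppose that $X=0$ and $Y>0$ at every point of $U$. Then the following are equivalent: (i) $f$ locally admits a smooth conjugate, that is, every point of $U$ has an open neighbourhood $W\subseteq U$ on which there is a smooth function $g:W\to\mathbb{R}$ with $\|\nabla f\|=\|\nabla g\|$ and $\langle\nabla f,\nabla g\rangle=0$ everywhere on $W$; (ii) $V=0$ and $$\tfrac{25}{14}N+\tfrac35G+\tfrac34F+\tfrac1{21}T-\tfrac{17}{21}ZK-\tfrac79ZA=0$$ at every point of $U$. -/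

import Mathlib

open scoped ContDiff

noncomputable section

namespace ConjugateFunctions

/-- Three-dimensional Euclidean space. -/
abbrev E3 : Type := EuclideanSpace ℝ (Fin 3)

/-- The `i`-th partial derivative `∇ᵢ h` in the standard coordinates. The flat metric is
`δᵢⱼ`, so indices are raised and lowered without change and a repeated index is summed. -/
def pd (i : Fin 3) (h : E3 → ℝ) (x : E3) : ℝ :=
  fderiv ℝ h x (EuclideanSpace.single i 1)

/-- `fᵢ = ∇ᵢ f`. -/
def d1 (f : E3 → ℝ) (i : Fin 3) : E3 → ℝ := pd i f

/-- `fᵢⱼ = ∇ᵢ∇ⱼ f`. -/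
def d2 (f : E3 → ℝ) (i j : Fin 3) : E3 → ℝ := pd i (d1 f j)

/-- `fᵢⱼₖ = ∇ᵢ∇ⱼ∇ₖ f`. -/
def d3 (f : E3 → ℝ) (i j k : Fin 3) : E3 → ℝ := pd i (d2 f j k)

/-- The Laplacian `fⁱᵢ`. -/
def lap (f : E3 → ℝ) (x : E3) : ℝ := ∑ i, d2 f i i x

/-- The 1-form `fᵢₖ fᵏ`. -/
def hessGrad (f : E3 → ℝ) (i : Fin 3) (x : E3) : ℝ := ∑ k, d2 f i k x * d1 f k x

/-- The scalar `fⁱʲ fᵢ fⱼ`. -/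
def hessGradGrad (f : E3 → ℝ) (x : E3) : ℝ := ∑ i, ∑ j, d2 f i j x * d1 f i x * d1 f j x

/-- The Kronecker delta, that is, the flat metric `gᵢⱼ`. -/
def kron (i j : Fin 3) : ℝ := if i = j then 1 else 0

/-- The alternating symbol `εⁱʲᵏ`, with `ε⁰¹² = 1`. -/
def eps (i j k : Fin 3) : ℝ :=
  (((j : ℕ) : ℝ) - ((i : ℕ) : ℝ)) * (((k : ℕ) : ℝ) - ((j : ℕ) : ℝ)) *
    (((k : ℕ) : ℝ) - ((i : ℕ) : ℝ)) / 2

/-- Symmetrisation `T₍ᵢⱼₖ₎` over three indices. -/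
def sym3 (T : Fin 3 → Fin 3 → Fin 3 → ℝ) (i j k : Fin 3) : ℝ :=
  (T i j k + T i k j + T j i k + T j k i + T k i j + T k j i) / 6

/-- `J = fⁱ fᵢ`. -/
def invJ (f : E3 → ℝ) (x : E3) : ℝ := ∑ i, d1 f i x * d1 f i x

/-- `Z = fⁱʲ fᵢ fⱼ + J fʲⱼ`. -/
def invZ (f : E3 → ℝ) (x : E3) : ℝ := hessGradGrad f x + invJ f x * lap f x

/-- `X = 2 fᵢʲ fⱼ fⁱᵏ fₖ - J fʲᵏ fⱼₖ + J (fʲⱼ)²`. -/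
def invX (f : E3 → ℝ) (x : E3) : ℝ :=
  2 * (∑ i, hessGrad f i x * hessGrad f i x)
    - invJ f x * (∑ j, ∑ k, d2 f j k x * d2 f j k x)
    + invJ f x * lap f x ^ 2

/-- `Y = Z² - 2 J X`. -/
def invY (f : E3 → ℝ) (x : E3) : ℝ := invZ f x ^ 2 - 2 * invJ f x * invX f x

/-- `σᵢ = J ∇ᵢ Z - 2 Z ∇ᵢ J`. -/
def sigma (f : E3 → ℝ) (i : Fin 3) (x : E3) : ℝ :=
  invJ f x * pd i (invZ f) x - 2 * invZ f x * pd i (invJ f) x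

/-- `φᵢⱼ = J fᵢⱼ - 2 f₍ᵢ fⱼ₎ᵏ fₖ - ⅓ J fᵏₖ gᵢⱼ + ⅔ fᵏˡ fₖ fₗ gᵢⱼ`. -/
def phi (f : E3 → ℝ) (i j : Fin 3) (x : E3) : ℝ :=
  invJ f x * d2 f i j x
    - (d1 f i x * hessGrad f j x + d1 f j x * hessGrad f i x)
    - 1 / 3 * invJ f x * lap f x * kron i j
    + 2 / 3 * hessGradGrad f x * kron i j

/-- The divergence `∇ˡ φₖₗ`. -/
def divPhi (f : E3 → ℝ) (k : Fin 3) (x : E3) : ℝ := ∑ l, pd l (phi f k l) x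

/-- The contraction `φₖₗ ∇ˡ J`. -/
def phiGradJ (f : E3 → ℝ) (k : Fin 3) (x : E3) : ℝ :=
  ∑ l, phi f k l x * pd l (invJ f) x

/-- `ρᵢⱼₖ`, the symmetric trace-free part of `J ∇ᵢ φⱼₖ - 3 φᵢⱼ ∇ₖ J`:
`ρᵢⱼₖ = J ∇₍ᵢ φⱼₖ₎ - 3 φ₍ᵢⱼ ∇ₖ₎ J - ⅖ J g₍ᵢⱼ ∇ˡ φₖ₎ₗ + 6/5 g₍ᵢⱼ φₖ₎ₗ ∇ˡ J`. -/
def rho (f : E3 → ℝ) (i j k : Fin 3) (x : E3) : ℝ :=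
  sym3 (fun a b c =>
    invJ f x * pd a (phi f b c) x
      - 3 * phi f a b x * pd c (invJ f) x
      - 2 / 5 * invJ f x * kron a b * divPhi f c x
      + 6 / 5 * kron a b * phiGradJ f c x) i j k

/-- `λⱼ = 2 J ∇ⁱ φᵢⱼ - φᵢⱼ ∇ⁱ J`. -/
def lam (f : E3 → ℝ) (j : Fin 3) (x : E3) : ℝ :=
  2 * invJ f x * divPhi f j x - phiGradJ f j x

/-- `A = σⁱ σᵢ`. -/
def invA (f : E3 → ℝ) (x : E3) : ℝ := ∑ i, sigma f i x * sigma f i x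

/-- `T = φⁱʲ σᵢ σⱼ`. -/
def invT (f : E3 → ℝ) (x : E3) : ℝ := ∑ i, ∑ j, phi f i j x * sigma f i x * sigma f j x

/-- `F = ρⁱʲᵏ φᵢⱼ λₖ`. -/
def invF (f : E3 → ℝ) (x : E3) : ℝ :=
  ∑ i, ∑ j, ∑ k, rho f i j k x * phi f i j x * lam f k x

/-- `G = φⁱʲ λᵢ λⱼ`. -/
def invG (f : E3 → ℝ) (x : E3) : ℝ := ∑ i, ∑ j, phi f i j x * lam f i x * lam f j x

/-- `K = σⁱ λᵢ`. -/
def invK (f : E3 → ℝ) (x : E3) : ℝ := ∑ i, sigma f i x * lam f i x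

/-- `N = σᵢ ρⁱʲᵏ φⱼₖ`. -/
def invN (f : E3 → ℝ) (x : E3) : ℝ :=
  ∑ i, ∑ j, ∑ k, sigma f i x * rho f i j k x * phi f j k x

/-- The symmetric form `Qⁱʲ = fⁱʲᵏ fₖ - 2 fⁱᵏ fₖʲ`. -/
def formQ (f : E3 → ℝ) (i j : Fin 3) (x : E3) : ℝ :=
  (∑ k, d3 f i j k x * d1 f k x) - 2 * ∑ k, d2 f i k x * d2 f k j x

/-- `υ = εʲᵏˡ (J fₖⁱ Qᵢⱼ - fⁱ Qᵢⱼ fₖₘ fᵐ) fₗ`. -/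
def upsilon (f : E3 → ℝ) (x : E3) : ℝ :=
  ∑ j, ∑ k, ∑ l, eps j k l *
    (invJ f x * (∑ i, d2 f k i x * formQ f i j x)
      - (∑ i, d1 f i x * formQ f i j x) * hessGrad f k x) * d1 f l x

/-- The odd invariant `V = 4 J υ`. -/
def invV (f : E3 → ℝ) (x : E3) : ℝ := 4 * invJ f x * upsilon f x

/-- `f` and `g` are conjugate on `W`: their gradients have the same length and are
orthogonal at every point of `W`. -/
def IsConjugateOn (f g : E3 → ℝ) (W : Set E3) : Prop :=
  ∀ x ∈ W, ‖gradient f x‖ = ‖gradient g x‖ ∧ inner ℝ (gradient f x) (gradient g x) = 0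

/-- `f` locally admits a smooth conjugate on `U`: every point of `U` has an open neighbourhood
in `U` on which there is a smooth function conjugate to `f`. -/
def LocallyAdmitsSmoothConjugate (f : E3 → ℝ) (U : Set E3) : Prop :=
  ∀ p ∈ U, ∃ W : Set E3, IsOpen W ∧ p ∈ W ∧ W ⊆ U ∧
    ∃ g : E3 → ℝ, ContDiffOn ℝ ∞ g W ∧ IsConjugateOn f g W

end ConjugateFunctions

end

open scoped ContDiff

noncomputable section

namespace ConjugateFunctions

/-! ### Tensor algebra on `ℝ³` and its behaviour under orthogonal changes of frame -/

/-! Write `v = ∇f`, `H` for the Hessian, `J = |v|²`, `B = H(v,v)`. A conjugate function is locally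
the same thing as a closed 1-form `ω` with `|ω| = |v|` and `ω ⟂ v`. Let `m i j = ∇ᵢ ωⱼ`.
Differentiating the two algebraic conditions gives `m v = -H ω` and `m ω = H v`. If `m` is
symmetric, pairing the first with `ω` yields `H(ω,ω) + B = 0`, so `ω` is a null vector of the
quadratic form `J H + B` on the plane orthogonal to `v`.

The hypothesis `X = 0` says that this form is degenerate. Since `Y = Z²` then, and `Z` is the trace
of the form, `Y > 0` says that the form has rank exactly one. Hence its null vectors are its kernel,
and `ω` is determined by the 2-jet of `f` up to sign (`jetR_eq_zero`, `jetR_jetOmega`). The only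
remaining question is whether this `ω` is closed.

Take an orthonormal frame with first vector along `v` and third along `ω`. The relations for `m v`
and `m ω` determine two of the three columns of `m`. Differentiating the kernel equation `R = 0`
determines the off-diagonal entries of the remaining column, as well as three third derivatives of
`f`. Closedness then amounts to two scalar equations, `t012 = 2pq` and `D = 0`, where `D = t122 + (a
+ 2h)p` (`symm_iff_frame`). In the frame `V` is a nonzero multiple of `t012 - 2pq`; once this
vanishes, the even invariant is a nonzero multiple of `D²` (`jetV_frame`, `jetE_frame`). The square
is natural, because the rotation by `π` about `v` changes the sign of `D`.

The frame computation applies because all invariants are built from operations equivariant under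
orthogonal changes of frame. `pd_symm_iff` turns it into a criterion for closedness of any `ω`
satisfying the algebraic conditions. It is applied to `∇g` for necessity, and for sufficiency to the
explicit smooth form `jetOmega`, which is integrated on a ball by the Poincaré lemma. -/

/-- Vectors, in components. -/
abbrev Vec : Type := Fin 3 → ℝ

/-- Tensors of rank two, in components. -/
abbrev Ten2 : Type := Fin 3 → Fin 3 → ℝ

/-- Tensors of rank three, in components. -/
abbrev Ten3 : Type := Fin 3 → Fin 3 → Fin 3 → ℝ

/-- The scalar product `xᵢ yᵢ`. -/
def dot (x y : Vec) : ℝ := ∑ k, x k * y k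

/-- The vector `Hᵢₖ xₖ`. -/
def mv (H : Ten2) (x : Vec) : Vec := fun i => dot (H i) x

/-- The tensor `Hᵢₖ Kⱼₖ`. -/
def mm (H K : Ten2) : Ten2 := fun i j => dot (H i) (K j)

/-- The tensor `Tᵢⱼₖ xₖ`. -/
def tv (T : Ten3) (x : Vec) : Ten2 := fun i => mv (T i) x

/-- The trace `Hᵢᵢ`. -/
def trc (H : Ten2) : ℝ := ∑ i, H i i

/-- The contraction `Tᵢⱼⱼ`. -/
def ctr (T : Ten3) : Vec := fun i => trc (T i)

/-- The contraction `Tₗₖₗ`. -/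
def cdiv (T : Ten3) : Vec := fun k => ∑ l, T l k l

/-- The contraction `Tᵢⱼₖ Hⱼₖ`. -/
def ct (T : Ten3) (H : Ten2) : Vec := fun i => trc (mm (T i) H)

/-- The tensor `xᵢ yⱼ`. -/
def outer (x y : Vec) : Ten2 := fun i j => x i * y j

/-- The tensor `xᵢ Hⱼₖ`. -/
def outer3 (x : Vec) (H : Ten2) : Ten3 := fun i j k => x i * H j k

/-- Exchange of the first two indices. -/
def swap12 (T : Ten3) : Ten3 := fun i j k => T j i k

/-- Exchange of the last two indices. -/
def swap23 (T : Ten3) : Ten3 := fun i j k => T i k j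

/-- The components `eₐᵢ xₐ` of the vector with components `xₐ` in the frame `e`. -/
def rot (e : Ten2) (x : Vec) : Vec := fun i => ∑ a, e a i * x a

/-- The components `eₐᵢ e_bⱼ H_ab` of the tensor with components `H_ab` in the frame `e`. -/
def rot2 (e H : Ten2) : Ten2 := fun i j => ∑ a, e a i * rot e (H a) j

/-- The components of the tensor with components `T_abc` in the frame `e`. -/
def rot3 (e : Ten2) (T : Ten3) : Ten3 := fun i j k => ∑ a, e a i * rot2 e (T a) j k

/-- The rows of `e` form an orthonormal frame. -/
def IsFrame (e : Ten2) : Prop := ∀ a b, dot (e a) (e b) = kron a b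

theorem dot_comm (x y : Vec) : dot x y = dot y x := by
  simp only [dot, mul_comm]

theorem dot_sum_left {ι : Type*} (s : Finset ι) (c : ι → ℝ) (x : ι → Vec) (y : Vec) :
    dot (fun k => ∑ a ∈ s, c a * x a k) y = ∑ a ∈ s, c a * dot (x a) y := by
  simp only [dot, Finset.sum_mul, Finset.mul_sum]
  rw [Finset.sum_comm]
  simp only [mul_assoc]

theorem dot_sum_right {ι : Type*} (s : Finset ι) (c : ι → ℝ) (x : ι → Vec) (y : Vec) :
    dot y (fun k => ∑ a ∈ s, c a * x a k) = ∑ a ∈ s, c a * dot y (x a) := by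
  rw [dot_comm, dot_sum_left]
  simp only [dot_comm]

theorem trc_sum {ι : Type*} (s : Finset ι) (c : ι → ℝ) (x : ι → Ten2) :
    trc (fun i j => ∑ a ∈ s, c a * x a i j) = ∑ a ∈ s, c a * trc (x a) := by
  simp only [trc, Finset.mul_sum]
  rw [Finset.sum_comm]

/-- Orthonormal rows give orthonormal columns, since a one-sided inverse of a square matrix is
two-sided. -/
theorem IsFrame.sum_mul_eq_kron {e : Ten2} (he : IsFrame e) (i j : Fin 3) :
    ∑ a, e a i * e a j = kron i j := by
  have h1 : Matrix.of e * (Matrix.of e).transpose = 1 := by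
    ext a b
    rw [Matrix.mul_apply]
    simpa [Matrix.one_apply, dot, kron] using he a b
  have h2 : ((Matrix.of e).transpose * Matrix.of e) i j = (1 : Matrix _ _ ℝ) i j := by
    rw [mul_eq_one_comm.mp h1]
  rw [Matrix.mul_apply] at h2
  simpa [Matrix.one_apply, kron] using h2

theorem sum_kron_mul (x : Vec) (a : Fin 3) : ∑ b, kron a b * x b = x a := by
  simp [kron]

theorem rot_dot_frame {e : Ten2} (he : IsFrame e) (x : Vec) :
    rot e (fun a => dot (e a) x) = x := by
  funext i
  simp only [rot, dot, Finset.mul_sum]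
  rw [Finset.sum_comm]
  simp only [← mul_assoc, ← Finset.sum_mul, he.sum_mul_eq_kron, sum_kron_mul]

theorem dot_frame_rot {e : Ten2} (he : IsFrame e) (x : Vec) (a : Fin 3) :
    dot (e a) (rot e x) = x a := by
  have : rot e x = fun k => ∑ b, x b * e b k := by
    funext k; simp only [rot, mul_comm]
  rw [this, dot_sum_right]
  simp only [he a, mul_comm (x _), sum_kron_mul]

theorem rot_injective {e : Ten2} (he : IsFrame e) : Function.Injective (rot e) := by
  intro x y h
  funext a
  rw [← dot_frame_rot he x a, h, dot_frame_rot he]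

theorem rot2_eq (e H : Ten2) (i j : Fin 3) :
    rot2 e H i j = rot e (fun a => rot e (H a) j) i := rfl

theorem rot3_eq (e : Ten2) (T : Ten3) (i j k : Fin 3) :
    rot3 e T i j k = rot e (fun a => rot2 e (T a) j k) i := rfl

theorem rot2_injective {e : Ten2} (he : IsFrame e) : Function.Injective (rot2 e) := by
  intro H K h
  funext a
  apply rot_injective he
  funext j
  have : (fun a => rot e (H a) j) = fun a => rot e (K a) j := by
    apply rot_injective he
    funext i
    exact congrFun (congrFun h i) j
  exact congrFun this a

/-- Surjectivity of `rot`, `rot2` and `rot3` lets a pointwise statement be transferred to a frame by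
replacing every tensor in it with its frame components. -/
theorem exists_rot {e : Ten2} (he : IsFrame e) (x : Vec) : ∃ y, rot e y = x :=
  ⟨_, rot_dot_frame he x⟩

theorem exists_rot2 {e : Ten2} (he : IsFrame e) (H : Ten2) : ∃ K, rot2 e K = H := by
  choose K hK using fun a => exists_rot he (fun j => dot (e a) (fun i => H i j))
  refine ⟨K, ?_⟩
  funext i j
  rw [rot2_eq]
  simp only [hK]
  exact congrFun (rot_dot_frame he (fun i => H i j)) i

theorem exists_rot3 {e : Ten2} (he : IsFrame e) (T : Ten3) : ∃ S, rot3 e S = T := by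
  choose S hS using fun a => exists_rot2 he (fun j k => dot (e a) (fun i => T i j k))
  refine ⟨S, ?_⟩
  funext i j k
  rw [rot3_eq]
  simp only [hS]
  exact congrFun (rot_dot_frame he (fun i => T i j k)) i

theorem rot_add (e : Ten2) (x y : Vec) : rot e (x + y) = rot e x + rot e y := by
  funext i
  simp only [rot, Pi.add_apply, mul_add, Finset.sum_add_distrib]

theorem rot_smul (e : Ten2) (c : ℝ) (x : Vec) : rot e (c • x) = c • rot e x := by
  funext i
  simp only [rot, Pi.smul_apply, smul_eq_mul, Finset.mul_sum, mul_left_comm]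

theorem rot_sub (e : Ten2) (x y : Vec) : rot e (x - y) = rot e x - rot e y := by
  funext i
  simp only [rot, Pi.sub_apply, mul_sub, Finset.sum_sub_distrib]

theorem rot_zero (e : Ten2) : rot e 0 = 0 := by
  funext i
  simp [rot]

theorem rot2_add (e H K : Ten2) : rot2 e (H + K) = rot2 e H + rot2 e K := by
  funext i j
  simp only [rot2, Pi.add_apply, rot_add, mul_add, Finset.sum_add_distrib]

theorem rot2_sub (e H K : Ten2) : rot2 e (H - K) = rot2 e H - rot2 e K := by
  funext i j
  simp only [rot2, Pi.sub_apply, rot_sub, mul_sub, Finset.sum_sub_distrib]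

theorem rot2_smul (e : Ten2) (c : ℝ) (H : Ten2) : rot2 e (c • H) = c • rot2 e H := by
  funext i j
  simp only [rot2, Pi.smul_apply, rot_smul, smul_eq_mul, Finset.mul_sum, mul_left_comm]

theorem rot2_zero (e : Ten2) : rot2 e 0 = 0 := by
  funext i j
  simp [rot2, rot]

theorem rot3_add (e : Ten2) (S T : Ten3) : rot3 e (S + T) = rot3 e S + rot3 e T := by
  funext i j k
  simp only [rot3, Pi.add_apply, rot2_add, mul_add, Finset.sum_add_distrib]

theorem rot3_sub (e : Ten2) (S T : Ten3) : rot3 e (S - T) = rot3 e S - rot3 e T := by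
  funext i j k
  simp only [rot3, Pi.sub_apply, rot2_sub, mul_sub, Finset.sum_sub_distrib]

theorem rot3_smul (e : Ten2) (c : ℝ) (T : Ten3) : rot3 e (c • T) = c • rot3 e T := by
  funext i j k
  simp only [rot3, Pi.smul_apply, rot2_smul, smul_eq_mul, Finset.mul_sum, mul_left_comm]

theorem rot2_outer (e : Ten2) (x y : Vec) : rot2 e (outer x y) = outer (rot e x) (rot e y) := by
  funext i j
  simp only [rot2, outer, rot]
  rw [Finset.sum_mul_sum]
  simp only [Finset.mul_sum]
  refine Finset.sum_congr rfl fun a _ => Finset.sum_congr rfl fun b _ => ?_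
  ring

theorem rot3_outer3 (e : Ten2) (x : Vec) (H : Ten2) :
    rot3 e (outer3 x H) = outer3 (rot e x) (rot2 e H) := by
  funext i j k
  simp only [rot3, outer3, rot, Finset.sum_mul]
  refine Finset.sum_congr rfl fun a _ => ?_
  have : rot2 e (outer3 x H a) = x a • rot2 e H := rot2_smul e (x a) H
  rw [this]
  simp only [Pi.smul_apply, smul_eq_mul]
  ring

theorem rot2_swap (e H : Ten2) : rot2 e (fun i j => H j i) = fun i j => rot2 e H j i := by
  funext i j
  simp only [rot2, rot, Finset.mul_sum]
  rw [Finset.sum_comm]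
  simp only [mul_left_comm]

theorem rot3_swap23 (e : Ten2) (T : Ten3) : rot3 e (swap23 T) = swap23 (rot3 e T) := by
  funext i j k
  change ∑ a, e a i * rot2 e (swap23 T a) j k = ∑ a, e a i * rot2 e (T a) k j
  refine Finset.sum_congr rfl fun a _ => ?_
  have : rot2 e (swap23 T a) j k = rot2 e (T a) k j :=
    congrFun (congrFun (rot2_swap e (T a)) j) k
  rw [this]

theorem rot3_swap12 (e : Ten2) (T : Ten3) : rot3 e (swap12 T) = swap12 (rot3 e T) := by
  funext i j k
  simp only [rot3, rot2, swap12, Finset.mul_sum]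
  rw [Finset.sum_comm]
  refine Finset.sum_congr rfl fun a _ => Finset.sum_congr rfl fun b _ => ?_
  rw [mul_left_comm]
  rfl

theorem rot2_kron {e : Ten2} (he : IsFrame e) : rot2 e kron = kron := by
  funext i j
  simp only [rot2, rot]
  rw [← he.sum_mul_eq_kron i j]
  refine Finset.sum_congr rfl fun a _ => ?_
  simp [kron]

theorem dot_rot {e : Ten2} (he : IsFrame e) (x y : Vec) : dot (rot e x) (rot e y) = dot x y := by
  have : rot e x = fun k => ∑ b, x b * e b k := by
    funext k; simp only [rot, mul_comm]
  rw [this, dot_sum_left]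
  simp only [dot_frame_rot he]
  rfl

theorem mv_rot {e : Ten2} (he : IsFrame e) (H : Ten2) (x : Vec) :
    mv (rot2 e H) (rot e x) = rot e (mv H x) := by
  funext i
  have : rot2 e H i = fun k => ∑ a, e a i * rot e (H a) k := rfl
  simp only [mv, this, dot_sum_left, dot_rot he]
  rfl

theorem mm_rot {e : Ten2} (he : IsFrame e) (H K : Ten2) :
    mm (rot2 e H) (rot2 e K) = rot2 e (mm H K) := by
  funext i j
  have h1 : rot2 e H i = fun k => ∑ a, e a i * rot e (H a) k := rfl
  have h2 : rot2 e K j = fun k => ∑ a, e a j * rot e (K a) k := rfl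
  simp only [mm, h1, dot_sum_left]
  simp only [h2, dot_sum_right, dot_rot he]
  rfl

theorem mv_sum {ι : Type*} (s : Finset ι) (c : ι → ℝ) (H : ι → Ten2) (x : Vec) (j : Fin 3) :
    mv (fun j k => ∑ a ∈ s, c a * H a j k) x j = ∑ a ∈ s, c a * mv (H a) x j :=
  dot_sum_left s c (fun a => H a j) x

theorem tv_rot {e : Ten2} (he : IsFrame e) (T : Ten3) (x : Vec) :
    tv (rot3 e T) (rot e x) = rot2 e (tv T x) := by
  funext i j
  have : rot3 e T i = fun j k => ∑ a, e a i * rot2 e (T a) j k := rfl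
  simp only [tv, this, mv_sum, mv_rot he]
  rfl

theorem trc_rot {e : Ten2} (he : IsFrame e) (H : Ten2) : trc (rot2 e H) = trc H := by
  simp only [trc, rot2, rot, Finset.mul_sum]
  rw [Finset.sum_comm]
  refine Finset.sum_congr rfl fun a _ => ?_
  rw [Finset.sum_comm]
  have (b : Fin 3) : ∑ i, e a i * (e b i * H a b) = kron a b * H a b := by
    rw [← he a b, dot, Finset.sum_mul]
    simp only [mul_assoc]
  simp only [this, sum_kron_mul]

theorem ctr_rot {e : Ten2} (he : IsFrame e) (T : Ten3) : ctr (rot3 e T) = rot e (ctr T) := by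
  funext i
  have : rot3 e T i = fun j k => ∑ a, e a i * rot2 e (T a) j k := rfl
  simp only [ctr, this, trc_sum, trc_rot he]
  rfl

theorem mm_sum {ι : Type*} (s : Finset ι) (c : ι → ℝ) (H : ι → Ten2) (K : Ten2) :
    mm (fun i j => ∑ a ∈ s, c a * H a i j) K = fun i j => ∑ a ∈ s, c a * mm (H a) K i j := by
  funext i j
  exact dot_sum_left s c (fun a => H a i) (K j)

theorem ct_rot {e : Ten2} (he : IsFrame e) (T : Ten3) (H : Ten2) :
    ct (rot3 e T) (rot2 e H) = rot e (ct T H) := by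
  funext i
  have : rot3 e T i = fun j k => ∑ a, e a i * rot2 e (T a) j k := rfl
  simp only [ct, this, mm_sum, trc_sum, mm_rot he, trc_rot he]
  rfl

theorem cdiv_rot {e : Ten2} (he : IsFrame e) (T : Ten3) : cdiv (rot3 e T) = rot e (cdiv T) := by
  have h (S : Ten3) : cdiv S = ctr (swap12 S) := rfl
  rw [h, h, ← rot3_swap12, ctr_rot he]

/-! ### The invariants as functions of the jet `(fᵢ, fᵢⱼ, fᵢⱼₖ)` -/

/-- `fⁱʲ fᵢ fⱼ` of a jet. -/
def jetB (v : Vec) (H : Ten2) : ℝ := dot (mv H v) v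

/-- `Z` of a jet. -/
def jetZ (v : Vec) (H : Ten2) : ℝ := jetB v H + dot v v * trc H

/-- `X` of a jet. -/
def jetX (v : Vec) (H : Ten2) : ℝ :=
  2 * dot (mv H v) (mv H v) - dot v v * trc (mm H H) + dot v v * trc H ^ 2

/-- The gradient of `fⁱʲ fᵢ fⱼ`. -/
def jetDB (v : Vec) (H : Ten2) (T : Ten3) : Vec :=
  mv (tv T v) v + (2 : ℝ) • mv H (mv H v)

/-- The gradient of `Z`. -/
def jetDZ (v : Vec) (H : Ten2) (T : Ten3) : Vec :=
  jetDB v H T + (2 * trc H) • mv H v + dot v v • ctr T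

/-- `σᵢ` of a jet. -/
def jetSigma (v : Vec) (H : Ten2) (T : Ten3) : Vec :=
  dot v v • jetDZ v H T - (4 * jetZ v H) • mv H v

/-- `φᵢⱼ` of a jet. -/
def jetPhi (v : Vec) (H : Ten2) : Ten2 :=
  dot v v • H - (outer v (mv H v) + outer (mv H v) v)
    + (2 / 3 * jetB v H - 1 / 3 * dot v v * trc H) • kron

/-- The gradient `fᵢₖⱼ fᵏ + fᵢₖ fᵏⱼ` of the 1-form `fⱼₖ fᵏ`. -/
def jetDHessGrad (v : Vec) (H : Ten2) (T : Ten3) : Ten2 := tv T v + mm H H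

/-- `∇ᵢ φⱼₖ` of a jet. -/
def jetDPhi (v : Vec) (H : Ten2) (T : Ten3) : Ten3 :=
  (2 : ℝ) • outer3 (mv H v) H + dot v v • T
    - (swap12 (outer3 (mv H v) H) + swap12 (outer3 v (jetDHessGrad v H T))
      + swap23 (swap12 (outer3 (mv H v) H)) + swap23 (swap12 (outer3 v (jetDHessGrad v H T))))
    + outer3 ((2 / 3 : ℝ) • jetDB v H T
        - (1 / 3 : ℝ) • ((2 * trc H) • mv H v + dot v v • ctr T)) kron

/-- `∇ˡ φₖₗ` of a jet. -/
def jetDiv (v : Vec) (H : Ten2) (T : Ten3) : Vec := cdiv (jetDPhi v H T)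

/-- `φₖₗ ∇ˡ J` of a jet. -/
def jetPhiGradJ (v : Vec) (H : Ten2) : Vec := (2 : ℝ) • mv (jetPhi v H) (mv H v)

/-- Symmetrisation over three indices, in terms of exchanges of neighbouring indices. -/
def symm3 (T : Ten3) : Ten3 :=
  (1 / 6 : ℝ) • (T + swap23 T + swap12 T + swap12 (swap23 T) + swap23 (swap12 T)
    + swap12 (swap23 (swap12 T)))

/-- `ρᵢⱼₖ` of a jet. -/
def jetRho (v : Vec) (H : Ten2) (T : Ten3) : Ten3 :=
  symm3 (dot v v • jetDPhi v H T - (6 : ℝ) • swap23 (swap12 (outer3 (mv H v) (jetPhi v H)))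
    - (2 / 5 * dot v v) • swap23 (swap12 (outer3 (jetDiv v H T) kron))
    + (6 / 5 : ℝ) • swap23 (swap12 (outer3 (jetPhiGradJ v H) kron)))

/-- `λⱼ` of a jet. -/
def jetLam (v : Vec) (H : Ten2) (T : Ten3) : Vec :=
  (2 * dot v v) • jetDiv v H T - jetPhiGradJ v H

/-- The even invariant whose vanishing characterises, together with `V = 0`, the functions
with a conjugate, as a function of `Z`, `σ`, `φ`, `ρ` and `λ`. -/
def evenForm (Z : ℝ) (s : Vec) (P : Ten2) (r : Ten3) (l : Vec) : ℝ :=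
  25 / 14 * dot s (ct r P) + 3 / 5 * dot (mv P l) l + 3 / 4 * trc (mm (tv r l) P)
    + 1 / 21 * dot (mv P s) s - 17 / 21 * (Z * dot s l) - 7 / 9 * (Z * dot s s)

/-- The even invariant of a jet. -/
def jetE (v : Vec) (H : Ten2) (T : Ten3) : ℝ :=
  evenForm (jetZ v H) (jetSigma v H T) (jetPhi v H) (jetRho v H T) (jetLam v H T)

/-- `Qᵢⱼ` of a jet. -/
def jetQ (v : Vec) (H : Ten2) (T : Ten3) : Ten2 := tv T v - (2 : ℝ) • mm H H

/-- The contraction `εʲᵏˡ Kₖⱼ vₗ`. -/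
def epsContr (K : Ten2) (v : Vec) : ℝ := ∑ j, ∑ k, ∑ l, eps j k l * K k j * v l

/-- `V` of a jet. -/
def jetV (v : Vec) (H : Ten2) (T : Ten3) : ℝ :=
  4 * dot v v * epsContr (dot v v • mm H (jetQ v H T) - outer (mv H v) (mv (jetQ v H T) v)) v

theorem jetPhi_apply (v : Vec) (H : Ten2) (i j : Fin 3) :
    jetPhi v H i j = dot v v * H i j - (v i * mv H v j + mv H v i * v j)
      + (2 / 3 * jetB v H - 1 / 3 * dot v v * trc H) * kron i j := rfl

theorem jetDPhi_apply (v : Vec) (H : Ten2) (T : Ten3) (w i j : Fin 3) :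
    jetDPhi v H T w i j = 2 * (mv H v w * H i j) + dot v v * T w i j
      - (mv H v i * H w j + v i * jetDHessGrad v H T w j + mv H v j * H w i
        + v j * jetDHessGrad v H T w i)
      + (2 / 3 * jetDB v H T w - 1 / 3 * (2 * trc H * mv H v w + dot v v * ctr T w)) * kron i j :=
  rfl

theorem symm3_apply (T : Ten3) (i j k : Fin 3) :
    symm3 T i j k = 1 / 6 * (T i j k + T i k j + T j i k + T j k i + T k i j + T k j i) := rfl

theorem jetRho_apply (v : Vec) (H : Ten2) (T : Ten3) (i j k : Fin 3) :
    jetRho v H T i j k = symm3 (fun a b c => dot v v * jetDPhi v H T a b c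
      - 6 * (mv H v c * jetPhi v H a b) - 2 / 5 * dot v v * (jetDiv v H T c * kron a b)
      + 6 / 5 * (jetPhiGradJ v H c * kron a b)) i j k := rfl

/-! ### Equivariance of the jet invariants under orthogonal changes of frame -/

section Equivariance

variable {e : Ten2}

theorem jetB_rot (he : IsFrame e) (v : Vec) (H : Ten2) :
    jetB (rot e v) (rot2 e H) = jetB v H := by
  simp only [jetB, mv_rot he, dot_rot he]

theorem jetZ_rot (he : IsFrame e) (v : Vec) (H : Ten2) :
    jetZ (rot e v) (rot2 e H) = jetZ v H := by
  simp only [jetZ, jetB_rot he, dot_rot he, trc_rot he]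

theorem jetX_rot (he : IsFrame e) (v : Vec) (H : Ten2) :
    jetX (rot e v) (rot2 e H) = jetX v H := by
  simp only [jetX, mv_rot he, mm_rot he, dot_rot he, trc_rot he]

theorem jetDB_rot (he : IsFrame e) (v : Vec) (H : Ten2) (T : Ten3) :
    jetDB (rot e v) (rot2 e H) (rot3 e T) = rot e (jetDB v H T) := by
  simp only [jetDB, mv_rot he, tv_rot he, rot_add, rot_smul]

theorem jetSigma_rot (he : IsFrame e) (v : Vec) (H : Ten2) (T : Ten3) :
    jetSigma (rot e v) (rot2 e H) (rot3 e T) = rot e (jetSigma v H T) := by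
  simp only [jetSigma, jetDZ, jetDB_rot he, jetZ_rot he, mv_rot he, ctr_rot he, dot_rot he,
    trc_rot he, rot_add, rot_sub, rot_smul]

theorem jetPhi_rot (he : IsFrame e) (v : Vec) (H : Ten2) :
    jetPhi (rot e v) (rot2 e H) = rot2 e (jetPhi v H) := by
  simp only [jetPhi, jetB_rot he, mv_rot he, dot_rot he, trc_rot he, rot2_add, rot2_sub,
    rot2_smul, rot2_outer, rot2_kron he]

theorem jetDPhi_rot (he : IsFrame e) (v : Vec) (H : Ten2) (T : Ten3) :
    jetDPhi (rot e v) (rot2 e H) (rot3 e T) = rot3 e (jetDPhi v H T) := by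
  simp only [jetDPhi, jetDHessGrad, jetDB_rot he, mv_rot he, dot_rot he, trc_rot he, tv_rot he,
    mm_rot he, ctr_rot he, rot3_add, rot3_sub, rot3_smul, rot3_outer3, rot3_swap12, rot3_swap23,
    rot2_add, rot_add, rot_sub, rot_smul, rot2_kron he]

theorem jetDiv_rot (he : IsFrame e) (v : Vec) (H : Ten2) (T : Ten3) :
    jetDiv (rot e v) (rot2 e H) (rot3 e T) = rot e (jetDiv v H T) := by
  simp only [jetDiv, jetDPhi_rot he, cdiv_rot he]

theorem jetPhiGradJ_rot (he : IsFrame e) (v : Vec) (H : Ten2) :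
    jetPhiGradJ (rot e v) (rot2 e H) = rot e (jetPhiGradJ v H) := by
  simp only [jetPhiGradJ, jetPhi_rot he, mv_rot he, rot_smul]

theorem jetRho_rot (he : IsFrame e) (v : Vec) (H : Ten2) (T : Ten3) :
    jetRho (rot e v) (rot2 e H) (rot3 e T) = rot3 e (jetRho v H T) := by
  simp only [jetRho, symm3, jetDPhi_rot he, jetPhi_rot he, jetDiv_rot he, jetPhiGradJ_rot he,
    mv_rot he, dot_rot he, rot3_add, rot3_sub, rot3_smul, rot3_outer3, rot3_swap12, rot3_swap23,
    rot2_kron he]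

theorem jetLam_rot (he : IsFrame e) (v : Vec) (H : Ten2) (T : Ten3) :
    jetLam (rot e v) (rot2 e H) (rot3 e T) = rot e (jetLam v H T) := by
  simp only [jetLam, jetDiv_rot he, jetPhiGradJ_rot he, dot_rot he, rot_sub, rot_smul]

/-- The jet expressions are written with index-free operations precisely so that equivariance
propagates by rewriting, with no expansion into components. -/
theorem jetE_rot (he : IsFrame e) (v : Vec) (H : Ten2) (T : Ten3) :
    jetE (rot e v) (rot2 e H) (rot3 e T) = jetE v H T := by
  simp only [jetE, evenForm, jetZ_rot he, jetSigma_rot he, jetPhi_rot he, jetRho_rot he,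
    jetLam_rot he, ct_rot he, tv_rot he, mv_rot he, mm_rot he, dot_rot he, trc_rot he]

/-- The alternating symbol contracted with three copies of `e` is `det e` times itself;
orthonormality plays no role. -/
theorem epsContr_rot (e K : Ten2) (v : Vec) :
    epsContr (rot2 e K) (rot e v) = (Matrix.of e).det * epsContr K v := by
  simp only [epsContr, eps, rot2, rot, Fin.sum_univ_three, Matrix.det_fin_three, Matrix.of_apply]
  norm_num
  ring

theorem IsFrame.det_ne_zero (he : IsFrame e) : (Matrix.of e).det ≠ 0 := by
  have h1 : Matrix.of e * (Matrix.of e).transpose = 1 := by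
    ext a b
    rw [Matrix.mul_apply]
    simpa [Matrix.one_apply, dot, kron] using he a b
  have h2 := congrArg Matrix.det h1
  rw [Matrix.det_mul, Matrix.det_one] at h2
  exact left_ne_zero_of_mul_eq_one h2

theorem jetV_rot (he : IsFrame e) (v : Vec) (H : Ten2) (T : Ten3) :
    jetV (rot e v) (rot2 e H) (rot3 e T) = (Matrix.of e).det * jetV v H T := by
  have h1 : jetQ (rot e v) (rot2 e H) (rot3 e T) = rot2 e (jetQ v H T) := by
    simp only [jetQ, tv_rot he, mm_rot he, rot2_sub, rot2_smul]
  rw [jetV, h1, mm_rot he, mv_rot he, mv_rot he, dot_rot he, ← rot2_outer, ← rot2_smul,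
    ← rot2_sub, epsContr_rot, jetV]
  ring

end Equivariance

/-! ### The invariants in an adapted frame -/

/-- The symmetric tensor of rank two with the given components. -/
def symTen2 (h00 h01 h02 h11 h12 h22 : ℝ) : Ten2 :=
  ![![h00, h01, h02], ![h01, h11, h12], ![h02, h12, h22]]

/-- The symmetric tensor of rank three with the given components. -/
def symTen3 (t000 t001 t002 t011 t012 t022 t111 t112 t122 t222 : ℝ) : Ten3 :=
  ![symTen2 t000 t001 t002 t011 t012 t022, symTen2 t001 t011 t012 t111 t112 t122,
    symTen2 t002 t012 t022 t112 t122 t222]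

theorem ten2_ext {H K : Ten2} (h0 : H 0 = K 0) (h1 : H 1 = K 1) (h2 : H 2 = K 2) : H = K := by
  funext i
  fin_cases i
  exacts [h0, h1, h2]

theorem ten3_ext {S T : Ten3} (h0 : S 0 = T 0) (h1 : S 1 = T 1) (h2 : S 2 = T 2) : S = T := by
  funext i
  fin_cases i
  exacts [h0, h1, h2]

theorem vec_ext {x y : Vec} (h0 : x 0 = y 0) (h1 : x 1 = y 1) (h2 : x 2 = y 2) : x = y := by
  funext i
  fin_cases i
  exacts [h0, h1, h2]

theorem eq_symTen2 {H : Ten2} (hs : ∀ i j, H i j = H j i) :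
    H = symTen2 (H 0 0) (H 0 1) (H 0 2) (H 1 1) (H 1 2) (H 2 2) := by
  apply ten2_ext <;> apply vec_ext <;> simp [symTen2, hs 1 0, hs 2 0, hs 2 1]

theorem eq_symTen3 {T : Ten3} (h1 : ∀ i j k, T i j k = T j i k) (h2 : ∀ i j k, T i j k = T i k j) :
    T = symTen3 (T 0 0 0) (T 0 0 1) (T 0 0 2) (T 0 1 1) (T 0 1 2) (T 0 2 2) (T 1 1 1) (T 1 1 2)
      (T 1 2 2) (T 2 2 2) := by
  have e (i : Fin 3) : T i = symTen2 (T i 0 0) (T i 0 1) (T i 0 2) (T i 1 1) (T i 1 2) (T i 2 2) :=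
    eq_symTen2 (h2 i)
  apply ten3_ext
  · exact e 0
  · rw [e 1, h1 1 0 0, h1 1 0 1, h1 1 0 2, h2 0 1 0]
    rfl
  · rw [e 2, h1 2 0 0, h1 2 0 1, h1 2 0 2, h2 0 2 0, h2 0 2 1, h1 2 1 1, h1 2 1 2, h2 1 2 1]
    rfl

section Frame

variable (s h p q a : ℝ)

/-- In this section the first frame vector points along `∇f` and the third along `ω`. The entries
`0` and `-(s * h)` of the Hessian express the kernel equation `jetR = 0`. Since the invariants are
homogeneous in `f`, extracting a factor `s = |∇f|` from all derivatives leaves a pure power of `s`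
in front of each result. -/
theorem dot_frame : dot ![s, 0, 0] ![s, 0, 0] = s ^ 2 := by
  simp [dot, Fin.sum_univ_three, sq]

theorem trc_frame : trc (symTen2 (s * h) (s * p) (s * q) (s * a) 0 (-(s * h))) = s * a := by
  simp [trc, symTen2, Fin.sum_univ_three]

theorem mv_frame : mv (symTen2 (s * h) (s * p) (s * q) (s * a) 0 (-(s * h))) ![s, 0, 0] =
    ![s ^ 2 * h, s ^ 2 * p, s ^ 2 * q] := by
  apply vec_ext <;> simp [mv, dot, symTen2, Fin.sum_univ_three] <;> ring

theorem jetB_frame :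
    jetB ![s, 0, 0] (symTen2 (s * h) (s * p) (s * q) (s * a) 0 (-(s * h))) = s ^ 3 * h := by
  rw [jetB, mv_frame]
  simp [dot, Fin.sum_univ_three]
  ring

theorem jetPhi_frame :
    jetPhi ![s, 0, 0] (symTen2 (s * h) (s * p) (s * q) (s * a) 0 (-(s * h))) =
      symTen2 (s ^ 3 * (-a - h) / 3) 0 0 (s ^ 3 * (2 * a + 2 * h) / 3) 0
        (s ^ 3 * (-a - h) / 3) := by
  apply ten2_ext <;> apply vec_ext <;> rw [jetPhi_apply, mv_frame, jetB_frame, dot_frame, trc_frame]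
    <;> simp [kron, symTen2] <;> ring

variable (D t002 t011 t022 t111 t112 : ℝ)

/-- Third derivatives, in an adapted frame, which satisfy the derivative of `X = 0`
and `V = 0`. -/
def frameT : Ten3 :=
  symTen3 (s * (-2 * p ^ 2 - t022)) (s * (-2 * a * p - (D - (a + 2 * h) * p))) (s * t002)
    (s * t011) (s * (2 * p * q)) (s * t022) (s * t111) (s * t112) (s * (D - (a + 2 * h) * p))
    (-(s * t002))

theorem ctr_frame : ctr (frameT s h p q a D t002 t011 t022 t111 t112) =
    ![s * (-2 * p ^ 2 + t011), s * (-2 * a * p + t111), s * t112] := by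
  apply vec_ext <;> simp [ctr, trc, frameT, symTen3, symTen2, Fin.sum_univ_three] <;> ring

theorem tv_frame : tv (frameT s h p q a D t002 t011 t022 t111 t112) ![s, 0, 0] =
    symTen2 (s ^ 2 * (-2 * p ^ 2 - t022)) (s ^ 2 * (-2 * a * p - (D - (a + 2 * h) * p)))
      (s ^ 2 * t002) (s ^ 2 * t011) (s ^ 2 * (2 * p * q)) (s ^ 2 * t022) := by
  apply ten2_ext <;> apply vec_ext <;>
    simp [tv, mv, dot, frameT, symTen3, symTen2, Fin.sum_univ_three] <;> ring

theorem jetDB_frame :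
    jetDB ![s, 0, 0] (symTen2 (s * h) (s * p) (s * q) (s * a) 0 (-(s * h)))
        (frameT s h p q a D t002 t011 t022 t111 t112) =
      ![s ^ 3 * (2 * h ^ 2 + 2 * q ^ 2 - t022),
        s ^ 3 * (4 * h * p + a * p - D), s ^ 3 * t002] := by
  rw [jetDB, tv_frame, mv_frame]
  apply vec_ext <;> simp [mv, dot, symTen2, Fin.sum_univ_three] <;> ring

theorem jetDHessGrad_frame :
    jetDHessGrad ![s, 0, 0] (symTen2 (s * h) (s * p) (s * q) (s * a) 0 (-(s * h)))
        (frameT s h p q a D t002 t011 t022 t111 t112) =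
      symTen2 (s ^ 2 * (h ^ 2 - p ^ 2 + q ^ 2 - t022)) (s ^ 2 * (3 * h * p - D))
        (s ^ 2 * t002) (s ^ 2 * (p ^ 2 + a ^ 2 + t011)) (s ^ 2 * (3 * p * q))
        (s ^ 2 * (q ^ 2 + h ^ 2 + t022)) := by
  rw [jetDHessGrad, tv_frame]
  apply ten2_ext <;> apply vec_ext <;>
    simp only [Pi.add_apply, mm] <;> simp [dot, symTen2, Fin.sum_univ_three] <;> ring

theorem jetDPhi_frame :
    jetDPhi ![s, 0, 0] (symTen2 (s * h) (s * p) (s * q) (s * a) 0 (-(s * h)))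
        (frameT s h p q a D t002 t011 t022 t111 t112) =
      ![symTen2 (s ^ 3 * (-2 * a * h - t011 + t022 - 2 * h ^ 2 + 2 * p ^ 2 - 2 * q ^ 2) / 3)
          (s ^ 3 * (-a * p - h * p)) 0
          (s ^ 3 * (4 * a * h + 2 * t011 - 2 * t022 + 4 * h ^ 2 - 4 * p ^ 2 + 4 * q ^ 2) / 3) 0
          (s ^ 3 * (-2 * a * h - t011 + t022 - 2 * h ^ 2 + 2 * p ^ 2 - 2 * q ^ 2) / 3),
        symTen2 (s ^ 3 * (D - a * p - t111 - 4 * h * p) / 3) (s ^ 3 * (-a ^ 2 - a * h)) 0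
          (s ^ 3 * (-2 * D + 2 * a * p + 2 * t111 + 8 * h * p) / 3) (s ^ 3 * (-a * q + t112))
          (s ^ 3 * (D - a * p - t111 - 4 * h * p) / 3),
        symTen2 (s ^ 3 * (-2 * a * q - t002 - t112) / 3) 0 0
          (s ^ 3 * (4 * a * q + 2 * t002 + 2 * t112) / 3) (s ^ 3 * (D - a * p - h * p))
          (s ^ 3 * (-2 * a * q - t002 - t112) / 3)] := by
  apply ten3_ext <;> apply ten2_ext <;> apply vec_ext <;>
    rw [jetDPhi_apply, mv_frame, jetDB_frame, jetDHessGrad_frame, dot_frame, trc_frame, ctr_frame]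
    <;> simp [kron, frameT, symTen3, symTen2] <;> ring

theorem jetDiv_frame :
    jetDiv ![s, 0, 0] (symTen2 (s * h) (s * p) (s * q) (s * a) 0 (-(s * h)))
        (frameT s h p q a D t002 t011 t022 t111 t112) =
      ![s ^ 3 * (-3 * a ^ 2 - 5 * a * h - t011 + t022 - 2 * h ^ 2 + 2 * p ^ 2 - 2 * q ^ 2) / 3,
        s ^ 3 * (D - 4 * a * p + 2 * t111 + 2 * h * p) / 3,
        s ^ 3 * (-5 * a * q - t002 + 2 * t112) / 3] := by
  rw [jetDiv, jetDPhi_frame]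
  apply vec_ext <;> simp [cdiv, symTen2, Fin.sum_univ_three] <;> ring

theorem jetPhiGradJ_frame :
    jetPhiGradJ ![s, 0, 0] (symTen2 (s * h) (s * p) (s * q) (s * a) 0 (-(s * h))) =
      ![s ^ 5 * (-2 * a * h - 2 * h ^ 2) / 3, s ^ 5 * (4 * a * p + 4 * h * p) / 3,
        s ^ 5 * (-2 * a * q - 2 * h * q) / 3] := by
  rw [jetPhiGradJ, jetPhi_frame]
  apply vec_ext <;> simp [mv, dot, symTen2, Fin.sum_univ_three] <;> ring

theorem jetSigma_frame :
    jetSigma ![s, 0, 0] (symTen2 (s * h) (s * p) (s * q) (s * a) 0 (-(s * h)))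
        (frameT s h p q a D t002 t011 t022 t111 t112) =
      ![s ^ 5 * (-2 * a * h + t011 - t022 - 2 * h ^ 2 - 2 * p ^ 2 + 2 * q ^ 2),
        s ^ 5 * (-D - 3 * a * p + t111), s ^ 5 * (-2 * a * q + t002 + t112 - 4 * h * q)] := by
  rw [jetSigma, jetDZ, jetZ, jetDB_frame, jetB_frame, mv_frame, dot_frame, trc_frame, ctr_frame]
  apply vec_ext <;> simp <;> ring

theorem jetLam_frame :
    jetLam ![s, 0, 0] (symTen2 (s * h) (s * p) (s * q) (s * a) 0 (-(s * h)))
        (frameT s h p q a D t002 t011 t022 t111 t112) =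
      ![s ^ 5 * (-6 * a ^ 2 - 8 * a * h - 2 * t011 + 2 * t022 - 2 * h ^ 2 + 4 * p ^ 2
          - 4 * q ^ 2) / 3,
        s ^ 5 * (2 * D - 12 * a * p + 4 * t111) / 3,
        s ^ 5 * (-8 * a * q - 2 * t002 + 4 * t112 + 2 * h * q) / 3] := by
  rw [jetLam, jetDiv_frame, jetPhiGradJ_frame]
  apply vec_ext <;> simp [dot, Fin.sum_univ_three] <;> ring

theorem jetRho_frame :
    jetRho ![s, 0, 0] (symTen2 (s * h) (s * p) (s * q) (s * a) 0 (-(s * h)))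
        (frameT s h p q a D t002 t011 t022 t111 t112) =
      symTen3
        (s ^ 5 * (2 * a ^ 2 + 6 * a * h - t011 + t022 + 4 * h ^ 2 + 2 * p ^ 2 - 2 * q ^ 2) / 5)
        (s ^ 5 * (D + 9 * a * p - 3 * t111) / 15)
        (s ^ 5 * (6 * a * q - t002 - 3 * t112 + 6 * h * q) / 15)
        (s ^ 5 * (-8 * a ^ 2 - 24 * a * h + 4 * t011 - 4 * t022 - 16 * h ^ 2 - 8 * p ^ 2
          + 8 * q ^ 2) / 15)
        0
        (s ^ 5 * (2 * a ^ 2 + 6 * a * h - t011 + t022 + 4 * h ^ 2 + 2 * p ^ 2 - 2 * q ^ 2) / 15)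
        (s ^ 5 * (-4 * D - 6 * a * p + 2 * t111) / 5)
        (s ^ 5 * (-24 * a * q + 4 * t002 + 12 * t112 - 24 * h * q) / 15)
        (s ^ 5 * (11 * D + 9 * a * p - 3 * t111) / 15)
        (s ^ 5 * (6 * a * q - t002 - 3 * t112 + 6 * h * q) / 5) := by
  apply ten3_ext <;> apply ten2_ext <;> apply vec_ext <;>
    rw [jetRho_apply, jetDiv_frame, jetPhiGradJ_frame, jetDPhi_frame, jetPhi_frame, mv_frame,
      dot_frame, symm3_apply]
    <;> simp [kron, symTen3, symTen2] <;> ring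

/-- The coefficients of the even invariant are those for which everything except `D ^ 2` cancels. In
`frameT` the component `122` is parametrised by `D`, which measures the failure of `m 2 1 = m 1 2`
for the derivative `m` of `ω`. -/
theorem jetE_frame :
    jetE ![s, 0, 0] (symTen2 (s * h) (s * p) (s * q) (s * a) 0 (-(s * h)))
        (frameT s h p q a D t002 t011 t022 t111 t112) = s ^ 13 * (a + h) * D ^ 2 := by
  have hZ : jetZ ![s, 0, 0] (symTen2 (s * h) (s * p) (s * q) (s * a) 0 (-(s * h)))
      = s ^ 3 * (a + h) := by
    rw [jetZ, jetB_frame, dot_frame, trc_frame]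
    ring
  rw [jetE, hZ, jetSigma_frame, jetPhi_frame, jetRho_frame, jetLam_frame]
  simp [evenForm, ct, tv, mm, mv, dot, trc, symTen3, symTen2, Fin.sum_univ_three]
  ring

end Frame

/-- Only the normal form of the Hessian enters; the third derivatives are arbitrary and unscaled
here. -/
theorem jetV_frame (s h p q a t000 t001 t002 t011 t012 t022 t111 t112 t122 t222 : ℝ) :
    jetV ![s, 0, 0] (symTen2 h p q a 0 (-h))
        (symTen3 t000 t001 t002 t011 t012 t022 t111 t112 t122 t222) =
      -4 * s ^ 5 * (a + h) * (s * t012 - 2 * p * q) := by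
  simp only [jetV, epsContr, eps, jetQ, outer, Pi.sub_apply, Pi.smul_apply, tv, mm, mv, dot,
    Fin.sum_univ_three]
  simp [symTen3, symTen2]
  ring

/-! ### Pointwise consequences, in an adapted frame -/

/-- The cross product. -/
def cross (x y : Vec) : Vec :=
  ![x 1 * y 2 - x 2 * y 1, x 2 * y 0 - x 0 * y 2, x 0 * y 1 - x 1 * y 0]

theorem dot_cross_left (x y : Vec) : dot x (cross x y) = 0 := by
  simp [dot, cross, Fin.sum_univ_three]
  ring

theorem dot_cross_right (x y : Vec) : dot y (cross x y) = 0 := by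
  simp [dot, cross, Fin.sum_univ_three]
  ring

theorem dot_cross_cross (x y : Vec) :
    dot (cross x y) (cross x y) = dot x x * dot y y - dot x y ^ 2 := by
  simp [dot, cross, Fin.sum_univ_three]
  ring

theorem dot_smul_left (c : ℝ) (x y : Vec) : dot (c • x) y = c * dot x y := by
  simp only [dot, Pi.smul_apply, smul_eq_mul, Finset.mul_sum, mul_assoc]

theorem dot_smul_right (c : ℝ) (x y : Vec) : dot x (c • y) = c * dot x y := by
  rw [dot_comm, dot_smul_left, dot_comm]

theorem dot_add_right (x y z : Vec) : dot x (y + z) = dot x y + dot x z := by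
  simp only [dot, Pi.add_apply, mul_add, Finset.sum_add_distrib]

theorem dot_sub_right (x y z : Vec) : dot x (y - z) = dot x y - dot x z := by
  simp only [dot, Pi.sub_apply, mul_sub, Finset.sum_sub_distrib]

theorem dot_self_nonneg (x : Vec) : 0 ≤ dot x x :=
  Finset.sum_nonneg fun k _ => mul_self_nonneg (x k)

theorem dot_self_eq_zero {x : Vec} : dot x x = 0 ↔ x = 0 := by
  rw [dot, Finset.sum_eq_zero_iff_of_nonneg fun k _ => mul_self_nonneg (x k)]
  simp [funext_iff]

theorem exists_frame {v w : Vec} (hv : dot v v ≠ 0) (hvw : dot v w = 0)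
    (hw : dot w w = dot v v) :
    ∃ (e : Ten2) (s : ℝ), IsFrame e ∧ 0 < s ∧ rot e ![s, 0, 0] = v ∧ rot e ![0, 0, s] = w := by
  have hJ : 0 < dot v v := lt_of_le_of_ne (dot_self_nonneg v) (Ne.symm hv)
  set s := √(dot v v) with hs
  have hs0 : 0 < s := Real.sqrt_pos.mpr hJ
  have hs2 : s * s = dot v v := Real.mul_self_sqrt hJ.le
  have hne : s ≠ 0 := hs0.ne'
  set n : Vec := s⁻¹ • v with hn
  set u : Vec := s⁻¹ • w with hu
  have hnn : dot n n = 1 := by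
    rw [hn, dot_smul_left, dot_smul_right, ← hs2]
    field_simp
  have huu : dot u u = 1 := by
    rw [hu, dot_smul_left, dot_smul_right, hw, ← hs2]
    field_simp
  have hun : dot u n = 0 := by
    rw [hu, hn, dot_smul_left, dot_smul_right, dot_comm, hvw]
    simp
  -- The third vector needed to complete the unit vectors along `v` and `w` to a frame is their
  -- cross product.
  refine ⟨![n, cross u n, u], s, ?_, hs0, ?_, ?_⟩
  · have h1 : dot (cross u n) (cross u n) = 1 := by
      rw [dot_cross_cross, hnn, huu, hun]
      norm_num
    intro a b
    fin_cases a <;> fin_cases b <;>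
      simp [kron, hnn, huu, hun, h1, dot_comm n u, dot_comm (cross u n), dot_cross_left,
        dot_cross_right]
  · funext i
    simp [rot, Fin.sum_univ_three, hn]
    field_simp
  · funext i
    simp [rot, Fin.sum_univ_three, hu]
    field_simp

theorem symm_of_rot2 {e : Ten2} (he : IsFrame e) {H : Ten2}
    (h : ∀ i j, rot2 e H i j = rot2 e H j i) (i j : Fin 3) : H i j = H j i := by
  have h1 : H = fun i j => H j i := by
    apply rot2_injective he
    refine Eq.trans ?_ (rot2_swap e H).symm
    funext i j
    exact h i j
  exact congrFun (congrFun h1 i) j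

theorem rot2_symm (e : Ten2) {H : Ten2} (h : ∀ i j, H i j = H j i) (i j : Fin 3) :
    rot2 e H i j = rot2 e H j i := by
  have h1 : H = fun i j => H j i := by
    funext i j
    exact h i j
  conv_lhs => rw [h1, rot2_swap]

theorem rot3_injective {e : Ten2} (he : IsFrame e) : Function.Injective (rot3 e) := by
  intro S T h
  funext a
  apply rot2_injective he
  funext j k
  have : (fun a => rot2 e (S a) j k) = fun a => rot2 e (T a) j k := by
    apply rot_injective he
    funext i
    exact congrFun (congrFun (congrFun h i) j) k
  exact congrFun this a

theorem symm12_of_rot3 {e : Ten2} (he : IsFrame e) {T : Ten3}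
    (h : ∀ i j k, rot3 e T i j k = rot3 e T j i k) (i j k : Fin 3) : T i j k = T j i k := by
  have h1 : T = swap12 T := by
    apply rot3_injective he
    rw [rot3_swap12]
    funext i j k
    exact h i j k
  exact congrFun (congrFun (congrFun h1 i) j) k

theorem symm23_of_rot3 {e : Ten2} (he : IsFrame e) {T : Ten3}
    (h : ∀ i j k, rot3 e T i j k = rot3 e T i k j) (i j k : Fin 3) : T i j k = T i k j := by
  have h1 : T = swap23 T := by
    apply rot3_injective he
    rw [rot3_swap23]
    funext i j k
    exact h i j k
  exact congrFun (congrFun (congrFun h1 i) j) k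

/-! ### The kernel equation for `ω` and the pointwise criterion for closedness -/

/-- The 1-form `J fᵢⱼ ωʲ + (fʲᵏ fⱼ fₖ) ωᵢ - (fʲᵏ fⱼ ωₖ) fᵢ`. It vanishes if `ω` is the gradient of
a conjugate function and `X = 0`. -/
def jetR (v : Vec) (H : Ten2) (w : Vec) : Vec :=
  dot v v • mv H w + jetB v H • w - dot (mv H v) w • v

/-- The derivative of `jetR`, where `m` is the derivative of `ω` and `c` that of
`fʲᵏ fⱼ ωₖ`. -/
def jetDR (v : Vec) (H : Ten2) (T : Ten3) (w : Vec) (m : Ten2) (c : Vec) : Ten2 :=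
  (2 : ℝ) • outer (mv H v) (mv H w) + dot v v • (tv T w + mm m H) + outer (jetDB v H T) w
    + jetB v H • m - outer c v - dot (mv H v) w • H

theorem jetR_rot {e : Ten2} (he : IsFrame e) (v : Vec) (H : Ten2) (w : Vec) :
    jetR (rot e v) (rot2 e H) (rot e w) = rot e (jetR v H w) := by
  simp only [jetR, jetB_rot he, mv_rot he, dot_rot he, rot_add, rot_sub, rot_smul]

theorem jetDR_rot {e : Ten2} (he : IsFrame e) (v : Vec) (H : Ten2) (T : Ten3) (w : Vec) (m : Ten2)
    (c : Vec) :
    jetDR (rot e v) (rot2 e H) (rot3 e T) (rot e w) (rot2 e m) (rot e c) =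
      rot2 e (jetDR v H T w m c) := by
  simp only [jetDR, jetB_rot he, jetDB_rot he, mv_rot he, tv_rot he, mm_rot he, dot_rot he,
    rot2_add, rot2_sub, rot2_smul, rot2_outer]

/-- A null vector of a degenerate quadratic form on a plane lies in its kernel. The form is `J H +
B` on the complement of `v`, `hB` says that `w` is null, and `jetR` is the form applied to `w`, with
its component along `v` removed. -/
theorem jetR_eq_zero {v w : Vec} {H : Ten2} (hv : dot v v ≠ 0) (hvw : dot v w = 0)
    (hw : dot w w = dot v v) (hH : ∀ i j, H i j = H j i) (hX : jetX v H = 0)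
    (hB : dot (mv H w) w + jetB v H = 0) : jetR v H w = 0 := by
  obtain ⟨e, s, he, hs, rfl, rfl⟩ := exists_frame hv hvw hw
  obtain ⟨H, rfl⟩ := exists_rot2 he H
  replace hH := symm_of_rot2 he hH
  rw [jetX_rot he] at hX
  rw [mv_rot he, dot_rot he, jetB_rot he] at hB
  rw [jetR_rot he]
  suffices jetR ![s, 0, 0] H ![0, 0, s] = 0 by rw [this, rot_zero]
  rw [eq_symTen2 hH] at hX hB ⊢
  generalize H 0 0 = h at *
  generalize H 0 1 = p at *
  generalize H 0 2 = q at *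
  generalize H 1 1 = a at *
  generalize H 1 2 = c at *
  generalize H 2 2 = b at *
  clear hH
  have hb : b = -h := by
    simp [jetB, mv, dot, symTen2, Fin.sum_univ_three] at hB
    have : s ^ 2 * (b + h) = 0 := by linear_combination hB
    have := (mul_eq_zero.mp this).resolve_left (by positivity)
    linarith
  subst hb
  -- In the frame `X = 2 s² ((a + h)(b + h) - c²)`, and `b + h = 0` already.
  have hc : c = 0 := by
    simp [jetX, mm, mv, dot, trc, symTen2, Fin.sum_univ_three] at hX
    have : s ^ 2 * c ^ 2 = 0 := by linear_combination (-1 / 2) * hX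
    exact pow_eq_zero_iff two_ne_zero |>.mp
      ((mul_eq_zero.mp this).resolve_left (by positivity))
  subst hc
  apply vec_ext <;>
    simp only [jetR, jetB, mv, dot, Pi.add_apply, Pi.sub_apply, Pi.smul_apply, smul_eq_mul,
      Fin.sum_univ_three] <;> simp [symTen2] <;> ring

/-- `h1` and `h2` fix the columns `0` and `2` of `m`, whose entries `m 0 2` and `m 2 0` agree
automatically. Symmetry is thus a condition on `m 0 1` and `m 2 1`, and `h3` expresses these through
third derivatives after division by `a + h`. The vector `c` can be arbitrary: it enters `jetDR` only
through `outer c v`, hence only in column `0`, which is not used. -/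
theorem symm_iff_frame {s h p q a : ℝ} (hs : s ≠ 0) (hz : a + h ≠ 0) {T : Ten3}
    (hT1 : ∀ i j k, T i j k = T j i k) (hT2 : ∀ i j k, T i j k = T i k j) {m : Ten2} {c : Vec}
    (h1 : mv m ![s, 0, 0]
      + mv (symTen2 (s * h) (s * p) (s * q) (s * a) 0 (-(s * h))) ![0, 0, s] = 0)
    (h2 : mv m ![0, 0, s] = mv (symTen2 (s * h) (s * p) (s * q) (s * a) 0 (-(s * h))) ![s, 0, 0])
    (h3 : jetDR ![s, 0, 0] (symTen2 (s * h) (s * p) (s * q) (s * a) 0 (-(s * h))) T ![0, 0, s] m c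
      = 0) :
    (∀ i j, m i j = m j i) ↔
      jetV ![s, 0, 0] (symTen2 (s * h) (s * p) (s * q) (s * a) 0 (-(s * h))) T = 0 ∧
      jetE ![s, 0, 0] (symTen2 (s * h) (s * p) (s * q) (s * a) 0 (-(s * h))) T = 0 := by
  have hT := eq_symTen3 hT1 hT2
  clear hT1 hT2
  have scale (x : ℝ) : ∃ y, x = s * y := ⟨x / s, by field_simp⟩
  obtain ⟨t000, e000⟩ := scale (T 0 0 0)
  obtain ⟨t001, e001⟩ := scale (T 0 0 1)
  obtain ⟨t002, e002⟩ := scale (T 0 0 2)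
  obtain ⟨t011, e011⟩ := scale (T 0 1 1)
  obtain ⟨t012, e012⟩ := scale (T 0 1 2)
  obtain ⟨t022, e022⟩ := scale (T 0 2 2)
  obtain ⟨t111, e111⟩ := scale (T 1 1 1)
  obtain ⟨t112, e112⟩ := scale (T 1 1 2)
  obtain ⟨t122, e122⟩ := scale (T 1 2 2)
  obtain ⟨t222, e222⟩ := scale (T 2 2 2)
  rw [e000, e001, e002, e011, e012, e022, e111, e112, e122, e222] at hT
  subst hT
  clear e000 e001 e002 e011 e012 e022 e111 e112 e122 e222
  have c1 (i : Fin 3) := congrFun h1 i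
  have c2 (i : Fin 3) := congrFun h2 i
  have c3 (i j : Fin 3) := congrFun (congrFun h3 i) j
  clear h1 h2 h3
  simp only [Pi.add_apply, Pi.zero_apply, mv, dot, Fin.sum_univ_three] at c1 c2
  have m00 : m 0 0 = -(s * q) := by
    have := c1 0
    simp [symTen2] at this
    exact mul_right_cancel₀ hs (by linear_combination this)
  have m10 : m 1 0 = 0 := by
    have := c1 1
    simp [symTen2, hs] at this
    exact this
  have m20 : m 2 0 = s * h := by
    have := c1 2
    simp [symTen2] at this
    exact mul_right_cancel₀ hs (by linear_combination this)
  have m02 : m 0 2 = s * h := by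
    have := c2 0
    simp [symTen2, hs] at this
    exact this
  have m12 : m 1 2 = s * p := by
    have := c2 1
    simp [symTen2, hs] at this
    exact this
  have m22 : m 2 2 = s * q := by
    have := c2 2
    simp [symTen2, hs] at this
    exact this
  simp only [jetDR, jetB, jetDB, Pi.add_apply, Pi.sub_apply, Pi.smul_apply, Pi.zero_apply, outer,
    tv, mm, mv, dot, smul_eq_mul, Fin.sum_univ_three] at c3
  have hs4 : s ^ 4 ≠ 0 := pow_ne_zero 4 hs
  have hs3 : s ^ 3 ≠ 0 := pow_ne_zero 3 hs
  -- Column `1` of the differentiated kernel equation determines the unknown entries of `m`. Column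
  -- `2`, used for `k02`, `k12` and `k22`, involves only known entries of `m` and so constrains the
  -- third derivatives of `f`.
  have k01 : s * t012 - 2 * s * p * q + (a + h) * m 0 1 = 0 := by
    have := c3 0 1
    simp [symTen3, symTen2, m00, m02] at this
    exact mul_left_cancel₀ hs3 (by linear_combination this)
  have k21 : s * t122 + s * h * p + (a + h) * m 2 1 = 0 := by
    have := c3 2 1
    simp [symTen3, symTen2, m20, m22] at this
    exact mul_left_cancel₀ hs3 (by linear_combination this)
  have k02 : t000 = -2 * p ^ 2 - t022 := by
    have := c3 0 2
    simp [symTen3, symTen2, m00, m02] at this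
    exact mul_left_cancel₀ hs4 (by linear_combination this)
  have k12 : t001 = -2 * a * p - t122 := by
    have := c3 1 2
    simp [symTen3, symTen2, m10, m12] at this
    exact mul_left_cancel₀ hs4 (by linear_combination this)
  have k22 : t222 = -t002 := by
    have := c3 2 2
    simp [symTen3, symTen2, m20, m22] at this
    exact mul_left_cancel₀ hs4 (by linear_combination this)
  clear c1 c2 c3
  subst k02 k12 k22
  rw [jetV_frame]
  have hE (ht : t012 = 2 * p * q) :
      jetE ![s, 0, 0] (symTen2 (s * h) (s * p) (s * q) (s * a) 0 (-(s * h)))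
        (symTen3 (s * (-2 * p ^ 2 - t022)) (s * (-2 * a * p - t122)) (s * t002) (s * t011)
          (s * t012) (s * t022) (s * t111) (s * t112) (s * t122) (s * -t002)) =
      s ^ 13 * (a + h) * (t122 + (a + 2 * h) * p) ^ 2 := by
    -- With `D = t122 + (a + 2h)p` the component `D - (a + 2h)p` of `frameT` is again `t122`.
    rw [← jetE_frame s h p q a (t122 + (a + 2 * h) * p) t002 t011 t022 t111 t112, frameT, ht,
      add_sub_cancel_right, mul_neg]
  constructor
  · intro hm
    have ht : t012 = 2 * p * q := by
      rw [hm 0 1, m10] at k01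
      exact mul_left_cancel₀ hs (by linear_combination k01)
    have hD : t122 + (a + 2 * h) * p = 0 := by
      rw [hm 2 1, m12] at k21
      exact (mul_eq_zero.mp (by linear_combination k21 : s * _ = 0)).resolve_left hs
    rw [hE ht, hD, ht]
    constructor <;> ring
  · rintro ⟨hV, hE0⟩
    have ht : t012 = 2 * p * q := by
      have : s ^ 8 * (a + h) * (t012 - 2 * p * q) = 0 := by linear_combination (-1 / 4) * hV
      have := (mul_eq_zero.mp this).resolve_left (mul_ne_zero (pow_ne_zero 8 hs) hz)
      linarith
    have hD : t122 + (a + 2 * h) * p = 0 := by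
      rw [hE ht] at hE0
      exact (pow_eq_zero_iff two_ne_zero).mp
        ((mul_eq_zero.mp hE0).resolve_left (mul_ne_zero (pow_ne_zero 13 hs) hz))
    have m01 : m 0 1 = 0 := by
      rw [ht] at k01
      exact (mul_eq_zero.mp (by linear_combination k01 : (a + h) * m 0 1 = 0)).resolve_left hz
    have m21 : m 2 1 = s * p := by
      exact mul_left_cancel₀ hz (by linear_combination k21 - s * hD)
    intro i j
    fin_cases i <;> fin_cases j <;> simp [m01, m10, m02, m20, m12, m21]

theorem symm_iff {v w : Vec} {H m : Ten2} {T : Ten3} {c : Vec} (hv : dot v v ≠ 0)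
    (hvw : dot v w = 0) (hw : dot w w = dot v v) (hH : ∀ i j, H i j = H j i)
    (hT1 : ∀ i j k, T i j k = T j i k) (hT2 : ∀ i j k, T i j k = T i k j)
    (hR : jetR v H w = 0) (hZ : jetZ v H ≠ 0) (h1 : mv m v + mv H w = 0) (h2 : mv m w = mv H v)
    (h3 : jetDR v H T w m c = 0) :
    (∀ i j, m i j = m j i) ↔ jetV v H T = 0 ∧ jetE v H T = 0 := by
  obtain ⟨e, s, he, hs, rfl, rfl⟩ := exists_frame hv hvw hw
  clear hv hvw hw
  obtain ⟨H, rfl⟩ := exists_rot2 he H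
  obtain ⟨m, rfl⟩ := exists_rot2 he m
  obtain ⟨T, rfl⟩ := exists_rot3 he T
  obtain ⟨c, rfl⟩ := exists_rot he c
  replace hH := symm_of_rot2 he hH
  replace hT1 := symm12_of_rot3 he hT1
  replace hT2 := symm23_of_rot3 he hT2
  rw [jetR_rot he] at hR
  rw [jetZ_rot he] at hZ
  rw [mv_rot he, mv_rot he, ← rot_add] at h1
  rw [mv_rot he, mv_rot he] at h2
  rw [jetDR_rot he] at h3
  replace hR := rot_injective he (hR.trans (rot_zero e).symm)
  replace h1 := rot_injective he (h1.trans (rot_zero e).symm)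
  replace h2 := rot_injective he h2
  replace h3 := rot2_injective he (h3.trans (rot2_zero e).symm)
  have hm : (∀ i j, rot2 e m i j = rot2 e m j i) ↔ ∀ i j, m i j = m j i :=
    ⟨symm_of_rot2 he, rot2_symm e⟩
  rw [jetV_rot he, jetE_rot he, mul_eq_zero, or_iff_right he.det_ne_zero, hm]
  clear hm he e
  have hs0 := hs.ne'
  have hH' := eq_symTen2 hH
  have scale (x : ℝ) : ∃ y, x = s * y := ⟨x / s, by field_simp⟩
  obtain ⟨h, e00⟩ := scale (H 0 0)
  obtain ⟨p, e01⟩ := scale (H 0 1)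
  obtain ⟨q, e02⟩ := scale (H 0 2)
  obtain ⟨a, e11⟩ := scale (H 1 1)
  -- The components `1` and `2` of `jetR = 0` bring the Hessian into the normal form of the frame
  -- computations.
  have c0 (i : Fin 3) := congrFun hR i
  simp only [jetR, jetB, mv, dot, Pi.add_apply, Pi.sub_apply, Pi.smul_apply, smul_eq_mul,
    Fin.sum_univ_three, Pi.zero_apply] at c0
  have e12 : H 1 2 = 0 := by
    have := c0 1
    simp [hs0] at this
    exact this
  have e22 : H 2 2 = -(s * h) := by
    have := c0 2
    simp [e00] at this
    exact mul_left_cancel₀ (pow_ne_zero 3 hs0) (by linear_combination this)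
  rw [e00, e01, e02, e11, e12, e22] at hH'
  clear c0 hR hH e00 e01 e02 e11 e12 e22
  subst hH'
  have hz : a + h ≠ 0 := by
    intro hz
    apply hZ
    rw [jetZ, jetB_frame, dot_frame, trc_frame]
    linear_combination s ^ 3 * hz
  exact symm_iff_frame hs0 hz hT1 hT2 h1 h2 h3

/-! ### The candidate for the gradient of a conjugate function -/

/-- A vector, depending linearly on `y`, which is orthogonal to `v`. If `X = 0`, it points in the
direction orthogonal to `v` and to the gradient of a conjugate function. -/
def jetM (v : Vec) (H : Ten2) (y : Vec) : Vec :=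
  dot v v • mv H (dot v v • y - dot v y • v)
    - dot v (mv H (dot v v • y - dot v y • v)) • v + jetB v H • (dot v v • y - dot v y • v)

theorem jetM_rot {e : Ten2} (he : IsFrame e) (v : Vec) (H : Ten2) (y : Vec) :
    jetM (rot e v) (rot2 e H) (rot e y) = rot e (jetM v H y) := by
  simp only [jetM, jetB_rot he, ← rot_smul, ← rot_sub, ← rot_add, mv_rot he, dot_rot he]

theorem dot_jetM (v : Vec) (H : Ten2) (y : Vec) : dot v (jetM v H y) = 0 := by
  simp only [jetM, dot_add_right, dot_sub_right, dot_smul_right]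
  ring

/-- The linear map `y ↦ jetM v H y` has trace `J Z ≠ 0`, so it cannot kill every basis vector. -/
theorem exists_jetM_ne_zero {v : Vec} {H : Ten2} (hv : dot v v ≠ 0) (hZ : jetZ v H ≠ 0) :
    ∃ k, jetM v H (kron k) ≠ 0 := by
  by_contra! h
  have h0 := congrFun (h 0) 0
  have h1 := congrFun (h 1) 1
  have h2 := congrFun (h 2) 2
  simp only [jetM, jetB, mv, dot, Pi.add_apply, Pi.sub_apply, Pi.smul_apply, smul_eq_mul,
    Fin.sum_univ_three, Pi.zero_apply, kron] at h0 h1 h2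
  simp at h0 h1 h2
  apply mul_ne_zero hv hZ
  simp only [jetZ, jetB, trc, mv, dot, Fin.sum_univ_three]
  linear_combination h0 + h1 + h2

/-- The direction of the gradient of a conjugate function. -/
def jetOmega (v : Vec) (H : Ten2) (y : Vec) : Vec :=
  (√(dot (jetM v H y) (jetM v H y)))⁻¹ • cross v (jetM v H y)

theorem dot_jetOmega (v : Vec) (H : Ten2) (y : Vec) : dot v (jetOmega v H y) = 0 := by
  rw [jetOmega, dot_smul_right, dot_cross_left, mul_zero]

theorem dot_jetOmega_self {v : Vec} {H : Ten2} {y : Vec} (hy : jetM v H y ≠ 0) :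
    dot (jetOmega v H y) (jetOmega v H y) = dot v v := by
  have h0 : dot (jetM v H y) (jetM v H y) ≠ 0 := fun h => hy (dot_self_eq_zero.mp h)
  rw [jetOmega, dot_smul_left, dot_smul_right, dot_cross_cross, dot_jetM, ← mul_assoc, ← mul_inv,
    Real.mul_self_sqrt (dot_self_nonneg _)]
  field_simp
  ring

/-- On the complement of `v`, `jetM` is `J` times the symmetric operator of the form `J H + B`. When
that operator has rank one, its kernel is orthogonal to its image. The vector orthogonal to both `v`
and a nonzero image vector therefore spans the kernel. -/
theorem jetR_jetOmega {v : Vec} {H : Ten2} {y : Vec} (hv : dot v v ≠ 0)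
    (hH : ∀ i j, H i j = H j i) (hX : jetX v H = 0) (hy : jetM v H y ≠ 0) :
    jetR v H (jetOmega v H y) = 0 := by
  have h1 := dot_jetOmega v H y
  have h2 := dot_jetOmega_self hy
  have h3 : dot (jetOmega v H y) (jetM v H y) = 0 := by
    rw [jetOmega, dot_smul_left, dot_comm (cross _ _), dot_cross_right, mul_zero]
  refine jetR_eq_zero hv h1 h2 hH hX ?_
  generalize jetOmega v H y = w at h1 h2 h3
  obtain ⟨e, s, he, hs, rfl, rfl⟩ := exists_frame hv h1 h2
  obtain ⟨H, rfl⟩ := exists_rot2 he H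
  obtain ⟨y, rfl⟩ := exists_rot he y
  replace hH := symm_of_rot2 he hH
  rw [jetX_rot he] at hX
  rw [jetM_rot he] at hy h3
  rw [dot_rot he] at h3
  rw [mv_rot he, dot_rot he, jetB_rot he]
  replace hy : jetM ![s, 0, 0] H y ≠ 0 := fun h => hy (by rw [h, rot_zero])
  clear h1 h2 hv he e
  rw [eq_symTen2 hH] at hX hy h3 ⊢
  generalize H 0 0 = h at *
  generalize H 0 1 = p at *
  generalize H 0 2 = q at *
  generalize H 1 1 = a at *
  generalize H 1 2 = c at *
  generalize H 2 2 = b at *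
  clear hH
  have hs0 := hs.ne'
  have hM : jetM ![s, 0, 0] (symTen2 h p q a c b) y =
      ![0, s ^ 4 * ((a + h) * y 1 + c * y 2), s ^ 4 * (c * y 1 + (b + h) * y 2)] := by
    apply vec_ext <;>
      simp only [jetM, jetB, mv, dot, Pi.add_apply, Pi.sub_apply, Pi.smul_apply, smul_eq_mul,
        Fin.sum_univ_three] <;> simp [symTen2] <;> ring
  rw [hM] at hy h3
  have k3 : c * y 1 + (b + h) * y 2 = 0 := by
    simp [dot, Fin.sum_univ_three, hs0] at h3
    exact h3
  have k2 : (a + h) * y 1 + c * y 2 ≠ 0 := by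
    intro k2
    apply hy
    rw [k2, k3]
    apply vec_ext <;> simp
  -- This is `X = 0`, the vanishing of the determinant of the form. Together with `k3` it makes the
  -- nonzero quantity in `k2` annihilate `b + h`.
  have k1 : (a + h) * (b + h) = c ^ 2 := by
    simp [jetX, mm, mv, dot, trc, symTen2, Fin.sum_univ_three] at hX
    exact mul_left_cancel₀ (pow_ne_zero 2 hs0) (by linear_combination (1 / 2) * hX)
  have hb : b + h = 0 := by
    refine (mul_eq_zero.mp (?_ : ((a + h) * y 1 + c * y 2) * (b + h) = 0)).resolve_left k2
    linear_combination y 1 * k1 + c * k3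
  simp [jetB, mv, dot, symTen2, Fin.sum_univ_three]
  linear_combination s ^ 2 * hb

/-! ### Partial derivatives -/

section PartialDerivatives

variable {h k : E3 → ℝ} {x : E3} {i j : Fin 3}

theorem pd_add (hh : DifferentiableAt ℝ h x) (hk : DifferentiableAt ℝ k x) :
    pd i (fun y => h y + k y) x = pd i h x + pd i k x := by
  simp [pd, fderiv_fun_add hh hk]

theorem pd_sub (hh : DifferentiableAt ℝ h x) (hk : DifferentiableAt ℝ k x) :
    pd i (fun y => h y - k y) x = pd i h x - pd i k x := by
  simp [pd, fderiv_fun_sub hh hk]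

theorem pd_mul (hh : DifferentiableAt ℝ h x) (hk : DifferentiableAt ℝ k x) :
    pd i (fun y => h y * k y) x = pd i h x * k x + h x * pd i k x := by
  simp [pd, fderiv_fun_mul hh hk]
  ring

theorem pd_mul_const (hh : DifferentiableAt ℝ h x) (c : ℝ) :
    pd i (fun y => h y * c) x = pd i h x * c := by
  rw [pd_mul hh (differentiableAt_const c)]
  simp [pd]

theorem pd_sum {F : Fin 3 → E3 → ℝ} (hF : ∀ l, DifferentiableAt ℝ (F l) x) :
    pd i (fun y => ∑ l, F l y) x = ∑ l, pd i (F l) x := by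
  simp [pd, fderiv_fun_sum fun l _ => hF l]

theorem pd_dot {F G : E3 → Vec} (hF : ∀ l, DifferentiableAt ℝ (fun y => F y l) x)
    (hG : ∀ l, DifferentiableAt ℝ (fun y => G y l) x) :
    pd i (fun y => dot (F y) (G y)) x =
      dot (fun l => pd i (fun y => F y l) x) (G x)
        + dot (F x) (fun l => pd i (fun y => G y l) x) := by
  simp only [dot]
  rw [pd_sum fun l => (hF l).fun_mul (hG l), ← Finset.sum_add_distrib]
  exact Finset.sum_congr rfl fun l _ => pd_mul (hF l) (hG l)

theorem pd_congr (hhk : h =ᶠ[nhds x] k) : pd i h x = pd i k x := by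
  rw [pd, pd, hhk.fderiv_eq]

theorem pd_eq_zero {W : Set E3} (hW : IsOpen W) (hx : x ∈ W) (h0 : ∀ y ∈ W, h y = 0) :
    pd i h x = 0 := by
  have : h =ᶠ[nhds x] fun _ => 0 := by
    filter_upwards [hW.mem_nhds hx] with y hy using h0 y hy
  rw [pd_congr this, pd]
  simp

theorem fderiv_apply_eq_sum (h : E3 → ℝ) (x v : E3) : fderiv ℝ h x v = ∑ l, v l * pd l h x := by
  have hv : v = ∑ l, v l • EuclideanSpace.single l (1 : ℝ) := by
    ext l
    simp [Fin.sum_univ_three]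
    fin_cases l <;> simp
  conv_lhs => rw [hv]
  simp [pd]

theorem contDiffOn_pd {U : Set E3} (hU : IsOpen U) (hh : ContDiffOn ℝ ∞ h U) (i : Fin 3) :
    ContDiffOn ℝ ∞ (pd i h) U :=
  (hh.fderiv_of_isOpen hU (by simp)).clm_apply contDiffOn_const

theorem pd_comm {U : Set E3} (hU : IsOpen U) (hh : ContDiffOn ℝ ∞ h U) (hx : x ∈ U) :
    pd i (pd j h) x = pd j (pd i h) x := by
  have hc : ContDiffAt ℝ ∞ h x := hh.contDiffAt (hU.mem_nhds hx)
  have hs := hc.isSymmSndFDerivAt (by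
    rw [minSmoothness_of_isRCLikeNormedField]
    exact WithTop.coe_le_coe.mpr (le_top : (2 : ℕ∞) ≤ ⊤))
  have hd : DifferentiableAt ℝ (fderiv ℝ h) x :=
    (hc.fderiv_right (m := 1) (by norm_cast)).differentiableAt (by norm_num)
  have key (a b : Fin 3) : pd a (pd b h) x =
      fderiv ℝ (fderiv ℝ h) x (EuclideanSpace.single a 1) (EuclideanSpace.single b 1) := by
    have : pd b h = fun y => fderiv ℝ h y (EuclideanSpace.single b 1) := rfl
    rw [this, pd, fderiv_clm_apply hd (by fun_prop)]
    simp
  rw [key, key]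
  exact hs _ _

end PartialDerivatives

/-! ### The invariants of a function as functions of its jet -/

/-- The gradient, in components. -/
def grad (f : E3 → ℝ) (x : E3) : Vec := fun i => d1 f i x

/-- The Hessian, in components. -/
def hess (f : E3 → ℝ) (x : E3) : Ten2 := fun i j => d2 f i j x

/-- The third derivatives, in components. -/
def third (f : E3 → ℝ) (x : E3) : Ten3 := fun i j k => d3 f i j k x

theorem hessGradGrad_eq (f : E3 → ℝ) (x : E3) :
    hessGradGrad f x = jetB (grad f x) (hess f x) := by
  simp only [hessGradGrad, jetB, dot, mv, grad, hess, Finset.sum_mul]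
  refine Finset.sum_congr rfl fun i _ => Finset.sum_congr rfl fun j _ => ?_
  ring

theorem invZ_eq (f : E3 → ℝ) (x : E3) : invZ f x = jetZ (grad f x) (hess f x) := by
  rw [invZ, hessGradGrad_eq]
  rfl

theorem phi_eq (f : E3 → ℝ) (i j : Fin 3) (x : E3) :
    phi f i j x = jetPhi (grad f x) (hess f x) i j := by
  have hJ : invJ f x = dot (grad f x) (grad f x) := rfl
  have hL : lap f x = trc (hess f x) := rfl
  have hg (i : Fin 3) : hessGrad f i x = mv (hess f x) (grad f x) i := rfl
  rw [phi, jetPhi_apply, hessGradGrad_eq, hJ, hL, hg, hg]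
  simp only [grad, hess]
  ring

section Jets

variable {f : E3 → ℝ} {x : E3}

theorem differentiableAt_dot {F G : E3 → Vec} (hF : ∀ l, DifferentiableAt ℝ (fun y => F y l) x)
    (hG : ∀ l, DifferentiableAt ℝ (fun y => G y l) x) :
    DifferentiableAt ℝ (fun y => dot (F y) (G y)) x :=
  DifferentiableAt.fun_sum fun l _ => (hF l).fun_mul (hG l)

theorem differentiableAt_invJ (h1 : ∀ i, DifferentiableAt ℝ (d1 f i) x) :
    DifferentiableAt ℝ (invJ f) x := differentiableAt_dot (F := grad f) (G := grad f) h1 h1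

theorem differentiableAt_lap (h2 : ∀ i j, DifferentiableAt ℝ (d2 f i j) x) :
    DifferentiableAt ℝ (lap f) x :=
  DifferentiableAt.fun_sum fun i _ => h2 i i

theorem differentiableAt_hessGrad (h1 : ∀ i, DifferentiableAt ℝ (d1 f i) x)
    (h2 : ∀ i j, DifferentiableAt ℝ (d2 f i j) x) (i : Fin 3) :
    DifferentiableAt ℝ (hessGrad f i) x :=
  differentiableAt_dot (F := fun y => hess f y i) (G := grad f) (h2 i) h1

theorem differentiableAt_jetB (h1 : ∀ i, DifferentiableAt ℝ (d1 f i) x)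
    (h2 : ∀ i j, DifferentiableAt ℝ (d2 f i j) x) :
    DifferentiableAt ℝ (fun y => jetB (grad f y) (hess f y)) x :=
  differentiableAt_dot (F := fun y => mv (hess f y) (grad f y)) (G := grad f)
    (differentiableAt_hessGrad h1 h2) h1

theorem pd_invJ (h1 : ∀ i, DifferentiableAt ℝ (d1 f i) x) (w : Fin 3) :
    pd w (invJ f) x = 2 * mv (hess f x) (grad f x) w := by
  have := pd_dot (i := w) (F := grad f) (G := grad f) h1 h1
  refine this.trans ?_
  rw [dot_comm (grad f x), two_mul]
  rfl

theorem pd_lap (h2 : ∀ i j, DifferentiableAt ℝ (d2 f i j) x) (w : Fin 3) :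
    pd w (lap f) x = ctr (third f x) w :=
  pd_sum fun i => h2 i i

theorem pd_hessGrad (h1 : ∀ i, DifferentiableAt ℝ (d1 f i) x)
    (h2 : ∀ i j, DifferentiableAt ℝ (d2 f i j) x) (w i : Fin 3) :
    pd w (hessGrad f i) x = jetDHessGrad (grad f x) (hess f x) (third f x) w i := by
  have := pd_dot (i := w) (F := fun y => hess f y i) (G := grad f) (h2 i) h1
  refine this.trans ?_
  rw [dot_comm (hess f x i)]
  rfl

/-- `mm` contracts second indices with each other, so symmetry is needed to read `mm H H` as the
square of `H`. -/
theorem dot_mm_self {H : Ten2} (hH : ∀ i j, H i j = H j i) (v : Vec) (w : Fin 3) :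
    dot (mm H H w) v = dot (H w) (mv H v) := by
  simp only [dot, mm, mv, Finset.sum_mul, Finset.mul_sum]
  rw [Finset.sum_comm]
  refine Finset.sum_congr rfl fun i _ => Finset.sum_congr rfl fun j _ => ?_
  rw [hH j i]
  ring

theorem pd_jetB (h1 : ∀ i, DifferentiableAt ℝ (d1 f i) x)
    (h2 : ∀ i j, DifferentiableAt ℝ (d2 f i j) x) (hs : ∀ i j, hess f x i j = hess f x j i)
    (w : Fin 3) :
    pd w (fun y => jetB (grad f y) (hess f y)) x =
      jetDB (grad f x) (hess f x) (third f x) w := by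
  have := pd_dot (i := w) (F := fun y => mv (hess f y) (grad f y)) (G := grad f)
    (differentiableAt_hessGrad h1 h2) h1
  refine this.trans ?_
  have h3 : (fun l => pd w (fun y => mv (hess f y) (grad f y) l) x) =
      tv (third f x) (grad f x) w + mm (hess f x) (hess f x) w := by
    funext l
    exact pd_hessGrad h1 h2 w l
  have h4 : (fun l => pd w (fun y => grad f y l) x) = hess f x w := rfl
  rw [h3, h4, dot_comm _ (grad f x), dot_add_right, dot_comm (grad f x) (mm _ _ _),
    dot_mm_self hs, dot_comm (mv _ _) (hess f x w), dot_comm (grad f x)]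
  simp only [jetDB, Pi.add_apply, Pi.smul_apply, smul_eq_mul, mv]
  ring

theorem pd_invZ (h1 : ∀ i, DifferentiableAt ℝ (d1 f i) x)
    (h2 : ∀ i j, DifferentiableAt ℝ (d2 f i j) x) (hs : ∀ i j, hess f x i j = hess f x j i)
    (w : Fin 3) : pd w (invZ f) x = jetDZ (grad f x) (hess f x) (third f x) w := by
  have hZ : invZ f = fun y => jetB (grad f y) (hess f y) + invJ f y * lap f y := by
    funext y
    exact invZ_eq f y
  have hJ := differentiableAt_invJ h1
  have hL := differentiableAt_lap h2
  rw [hZ, pd_add (differentiableAt_jetB h1 h2) (hJ.fun_mul hL), pd_mul hJ hL, pd_invJ h1, pd_lap h2,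
    pd_jetB h1 h2 hs]
  simp only [jetDZ, Pi.add_apply, Pi.smul_apply, smul_eq_mul]
  have e1 : invJ f x = dot (grad f x) (grad f x) := rfl
  have e2 : lap f x = trc (hess f x) := rfl
  rw [e1, e2]
  ring

theorem pd_phi (h1 : ∀ i, DifferentiableAt ℝ (d1 f i) x)
    (h2 : ∀ i j, DifferentiableAt ℝ (d2 f i j) x) (hs : ∀ i j, hess f x i j = hess f x j i)
    (w i j : Fin 3) :
    pd w (phi f i j) x = jetDPhi (grad f x) (hess f x) (third f x) w i j := by
  have hJ := differentiableAt_invJ h1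
  have hL := differentiableAt_lap h2
  have hB := differentiableAt_jetB h1 h2
  have hg := differentiableAt_hessGrad h1 h2
  have hP : phi f i j = fun y => invJ f y * d2 f i j y
      - (d1 f i y * hessGrad f j y + d1 f j y * hessGrad f i y)
      - invJ f y * lap f y * (1 / 3 * kron i j)
      + jetB (grad f y) (hess f y) * (2 / 3 * kron i j) := by
    funext y
    rw [phi, hessGradGrad_eq]
    ring
  rw [hP, pd_add (((hJ.fun_mul (h2 i j)).fun_sub (((h1 i).fun_mul (hg j)).fun_add ((h1 j).fun_mul (hg i)))).fun_sub
      ((hJ.fun_mul hL).mul_const _)) (hB.mul_const _),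
    pd_sub ((hJ.fun_mul (h2 i j)).fun_sub (((h1 i).fun_mul (hg j)).fun_add ((h1 j).fun_mul (hg i))))
      ((hJ.fun_mul hL).mul_const _),
    pd_sub (hJ.fun_mul (h2 i j)) (((h1 i).fun_mul (hg j)).fun_add ((h1 j).fun_mul (hg i))),
    pd_add ((h1 i).fun_mul (hg j)) ((h1 j).fun_mul (hg i)), pd_mul hJ (h2 i j), pd_mul (h1 i) (hg j),
    pd_mul (h1 j) (hg i), pd_mul_const (hJ.fun_mul hL), pd_mul_const hB, pd_mul hJ hL, pd_invJ h1,
    pd_lap h2, pd_jetB h1 h2 hs, pd_hessGrad h1 h2, pd_hessGrad h1 h2, jetDPhi_apply]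
  have e1 : invJ f x = dot (grad f x) (grad f x) := rfl
  have e2 : lap f x = trc (hess f x) := rfl
  have e3 : pd w (d2 f i j) x = third f x w i j := rfl
  have e4 (k : Fin 3) : pd w (d1 f k) x = hess f x w k := rfl
  have e5 (k : Fin 3) : d1 f k x = grad f x k := rfl
  have e6 (k : Fin 3) : hessGrad f k x = mv (hess f x) (grad f x) k := rfl
  have e7 : d2 f i j x = hess f x i j := rfl
  rw [e1, e2, e3, e4, e4, e5, e5, e6, e6, e7]
  ring

theorem sigma_eq (h1 : ∀ i, DifferentiableAt ℝ (d1 f i) x)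
    (h2 : ∀ i j, DifferentiableAt ℝ (d2 f i j) x) (hs : ∀ i j, hess f x i j = hess f x j i)
    (i : Fin 3) : sigma f i x = jetSigma (grad f x) (hess f x) (third f x) i := by
  rw [sigma, pd_invZ h1 h2 hs, pd_invJ h1, invZ_eq]
  have e1 : invJ f x = dot (grad f x) (grad f x) := rfl
  simp only [jetSigma, Pi.sub_apply, Pi.smul_apply, smul_eq_mul, e1]
  ring

theorem divPhi_eq (h1 : ∀ i, DifferentiableAt ℝ (d1 f i) x)
    (h2 : ∀ i j, DifferentiableAt ℝ (d2 f i j) x) (hs : ∀ i j, hess f x i j = hess f x j i)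
    (i : Fin 3) : divPhi f i x = jetDiv (grad f x) (hess f x) (third f x) i := by
  simp only [divPhi, pd_phi h1 h2 hs]
  rfl

theorem phiGradJ_eq (h1 : ∀ i, DifferentiableAt ℝ (d1 f i) x) (i : Fin 3) :
    phiGradJ f i x = jetPhiGradJ (grad f x) (hess f x) i := by
  simp only [phiGradJ, pd_invJ h1, phi_eq, jetPhiGradJ, Pi.smul_apply, smul_eq_mul, mv, dot,
    Finset.mul_sum, mul_left_comm]

theorem rho_eq (h1 : ∀ i, DifferentiableAt ℝ (d1 f i) x)
    (h2 : ∀ i j, DifferentiableAt ℝ (d2 f i j) x) (hs : ∀ i j, hess f x i j = hess f x j i)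
    (i j k : Fin 3) : rho f i j k x = jetRho (grad f x) (hess f x) (third f x) i j k := by
  have e1 : invJ f x = dot (grad f x) (grad f x) := rfl
  simp only [rho, sym3, pd_phi h1 h2 hs, divPhi_eq h1 h2 hs, phiGradJ_eq h1, phi_eq, pd_invJ h1,
    jetRho_apply, symm3_apply, e1]
  ring

theorem lam_eq (h1 : ∀ i, DifferentiableAt ℝ (d1 f i) x)
    (h2 : ∀ i j, DifferentiableAt ℝ (d2 f i j) x) (hs : ∀ i j, hess f x i j = hess f x j i)
    (i : Fin 3) : lam f i x = jetLam (grad f x) (hess f x) (third f x) i := by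
  rw [lam, divPhi_eq h1 h2 hs, phiGradJ_eq h1]
  rfl

theorem evenInvariant_eq (h1 : ∀ i, DifferentiableAt ℝ (d1 f i) x)
    (h2 : ∀ i j, DifferentiableAt ℝ (d2 f i j) x) (hs : ∀ i j, hess f x i j = hess f x j i) :
    25 / 14 * invN f x + 3 / 5 * invG f x + 3 / 4 * invF f x + 1 / 21 * invT f x
      - 17 / 21 * (invZ f x * invK f x) - 7 / 9 * (invZ f x * invA f x) =
    jetE (grad f x) (hess f x) (third f x) := by
  simp only [invN, invG, invF, invT, invK, invA, sigma_eq h1 h2 hs, rho_eq h1 h2 hs,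
    lam_eq h1 h2 hs, phi_eq, invZ_eq]
  rw [jetE]
  generalize jetSigma (grad f x) (hess f x) (third f x) = s
  generalize jetRho (grad f x) (hess f x) (third f x) = r
  generalize jetLam (grad f x) (hess f x) (third f x) = l
  generalize jetPhi (grad f x) (hess f x) = P
  generalize jetZ (grad f x) (hess f x) = Z
  have eN : dot s (ct r P) = ∑ i, ∑ j, ∑ k, s i * r i j k * P j k := by
    simp only [dot, ct, trc, mm, Finset.mul_sum, mul_assoc]
  have eQ (y : Vec) : dot (mv P y) y = ∑ i, ∑ j, P i j * y i * y j := by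
    simp only [dot, mv, Finset.sum_mul]
    refine Finset.sum_congr rfl fun i _ => Finset.sum_congr rfl fun j _ => ?_
    ring
  have eF : trc (mm (tv r l) P) = ∑ i, ∑ j, ∑ k, r i j k * P i j * l k := by
    simp only [trc, mm, tv, mv, dot, Finset.sum_mul]
    refine Finset.sum_congr rfl fun i _ => Finset.sum_congr rfl fun j _ =>
      Finset.sum_congr rfl fun k _ => ?_
    ring
  rw [evenForm, eN, eQ, eQ, eF, dot, dot]

theorem invV_eq (hs : ∀ i j, hess f x i j = hess f x j i)
    (ht : ∀ i j k, third f x i j k = third f x j i k) :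
    invV f x = jetV (grad f x) (hess f x) (third f x) := by
  have hQ (i j : Fin 3) : formQ f i j x = jetQ (grad f x) (hess f x) (third f x) j i := by
    have e1 : formQ f i j x = dot (third f x i j) (grad f x)
        - 2 * ∑ k, hess f x i k * hess f x k j := rfl
    have e2 : jetQ (grad f x) (hess f x) (third f x) j i = dot (third f x j i) (grad f x)
        - 2 * ∑ k, hess f x j k * hess f x i k := rfl
    have e3 : third f x i j = third f x j i := funext (ht i j)
    rw [e1, e2, e3]
    congr 2
    refine Finset.sum_congr rfl fun k _ => ?_
    rw [hs k j, mul_comm]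
  have e1 : invJ f x = dot (grad f x) (grad f x) := rfl
  simp only [invV, upsilon, hQ, jetV, epsContr, e1]
  congr 1
  refine Finset.sum_congr rfl fun j _ => Finset.sum_congr rfl fun k _ =>
    Finset.sum_congr rfl fun l _ => ?_
  have e2 : ∑ i, d1 f i x * jetQ (grad f x) (hess f x) (third f x) j i =
      mv (jetQ (grad f x) (hess f x) (third f x)) (grad f x) j := by
    simp only [mv, dot, mul_comm]
    rfl
  rw [e2, mul_comm (mv _ _ j)]
  rfl

/-- The derivative of the coefficient of `∇f` is left unexpanded, since the pointwise criterion
accepts any value for it. -/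
theorem pd_jetR {η : E3 → Vec} (h1 : ∀ i, DifferentiableAt ℝ (d1 f i) x)
    (h2 : ∀ i j, DifferentiableAt ℝ (d2 f i j) x) (hs : ∀ i j, hess f x i j = hess f x j i)
    (hη : ∀ i, DifferentiableAt ℝ (fun y => η y i) x) (w i : Fin 3) :
    pd w (fun y => jetR (grad f y) (hess f y) (η y) i) x =
      jetDR (grad f x) (hess f x) (third f x) (η x) (fun a b => pd a (fun y => η y b) x)
        (fun a => pd a (fun y => dot (mv (hess f y) (grad f y)) (η y)) x) w i := by
  have hJ := differentiableAt_invJ h1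
  have hB := differentiableAt_jetB h1 h2
  have hg := differentiableAt_hessGrad h1 h2
  have hHη : DifferentiableAt ℝ (fun y => dot (hess f y i) (η y)) x :=
    differentiableAt_dot (h2 i) hη
  have hb : DifferentiableAt ℝ (fun y => dot (mv (hess f y) (grad f y)) (η y)) x :=
    differentiableAt_dot hg hη
  have hR : (fun y => jetR (grad f y) (hess f y) (η y) i) = fun y =>
      invJ f y * dot (hess f y i) (η y) + jetB (grad f y) (hess f y) * η y i
        - dot (mv (hess f y) (grad f y)) (η y) * d1 f i y := rfl
  rw [hR, pd_sub ((hJ.fun_mul hHη).fun_add (hB.fun_mul (hη i))) (hb.fun_mul (h1 i)),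
    pd_add (hJ.fun_mul hHη) (hB.fun_mul (hη i)), pd_mul hJ hHη, pd_mul hB (hη i), pd_mul hb (h1 i),
    pd_dot (F := fun y => hess f y i) (h2 i) hη, pd_invJ h1, pd_jetB h1 h2 hs]
  have e1 : invJ f x = dot (grad f x) (grad f x) := rfl
  have e2 : (fun l => pd w (fun y => hess f y i l) x) = third f x w i := rfl
  have e3 : pd w (d1 f i) x = hess f x w i := rfl
  have e4 : d1 f i x = grad f x i := rfl
  rw [e1, e2, e3, e4, dot_comm (hess f x i) (fun l => pd w (fun y => η y l) x)]
  simp only [jetDR, outer, tv, mm, mv, Pi.add_apply, Pi.sub_apply, Pi.smul_apply, smul_eq_mul]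
  ring

end Jets

/-! ### Closedness of the 1-form determined by `X = 0` -/

section Closedness

variable {f : E3 → ℝ} {U : Set E3} {x : E3}

theorem differentiableAt_of_contDiffOn {h : E3 → ℝ} (hU : IsOpen U) (hh : ContDiffOn ℝ ∞ h U)
    (hx : x ∈ U) : DifferentiableAt ℝ h x :=
  (hh.contDiffAt (hU.mem_nhds hx)).differentiableAt (by simp)

theorem contDiffOn_d1 (hU : IsOpen U) (hf : ContDiffOn ℝ ∞ f U) (i : Fin 3) :
    ContDiffOn ℝ ∞ (d1 f i) U := contDiffOn_pd hU hf i

theorem contDiffOn_d2 (hU : IsOpen U) (hf : ContDiffOn ℝ ∞ f U) (i j : Fin 3) :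
    ContDiffOn ℝ ∞ (d2 f i j) U := contDiffOn_pd hU (contDiffOn_d1 hU hf j) i

theorem hess_symm (hU : IsOpen U) (hf : ContDiffOn ℝ ∞ f U) (hx : x ∈ U) (i j : Fin 3) :
    hess f x i j = hess f x j i := pd_comm hU hf hx

theorem third_symm12 (hU : IsOpen U) (hf : ContDiffOn ℝ ∞ f U) (hx : x ∈ U) (i j k : Fin 3) :
    third f x i j k = third f x j i k := pd_comm hU (contDiffOn_d1 hU hf k) hx

/-- Here the symmetry of the Hessian is differentiated, so it is needed near `x` and not only at
`x`. -/
theorem third_symm23 (hU : IsOpen U) (hf : ContDiffOn ℝ ∞ f U) (hx : x ∈ U) (i j k : Fin 3) :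
    third f x i j k = third f x i k j := by
  refine pd_congr ?_
  filter_upwards [hU.mem_nhds hx] with y hy using hess_symm hU hf hy j k

theorem mv_pd_add_mv_hess {η : E3 → Vec} (hU : IsOpen U) (hf : ContDiffOn ℝ ∞ f U)
    (hη : ∀ i, ∀ y ∈ U, DifferentiableAt ℝ (fun y => η y i) y)
    (hperp : ∀ y ∈ U, dot (grad f y) (η y) = 0) (hx : x ∈ U) :
    mv (fun a b => pd a (fun y => η y b) x) (grad f x) + mv (hess f x) (η x) = 0 := by
  funext w
  have h1 (i : Fin 3) := differentiableAt_of_contDiffOn hU (contDiffOn_d1 hU hf i) hx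
  have h := pd_eq_zero (i := w) hU hx hperp
  rw [pd_dot (F := grad f) h1 fun i => hη i x hx, dot_comm (grad f x)] at h
  rw [add_comm]
  exact h

theorem mv_pd_eq_mv_hess {η : E3 → Vec} (hU : IsOpen U) (hf : ContDiffOn ℝ ∞ f U)
    (hη : ∀ i, ∀ y ∈ U, DifferentiableAt ℝ (fun y => η y i) y)
    (hlen : ∀ y ∈ U, dot (η y) (η y) = dot (grad f y) (grad f y)) (hx : x ∈ U) :
    mv (fun a b => pd a (fun y => η y b) x) (η x) = mv (hess f x) (grad f x) := by
  funext w
  have h1 (i : Fin 3) := differentiableAt_of_contDiffOn hU (contDiffOn_d1 hU hf i) hx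
  have h := pd_congr (i := w) (Filter.eventuallyEq_of_mem (hU.mem_nhds hx) hlen)
  rw [pd_dot (fun i => hη i x hx) fun i => hη i x hx, pd_dot (F := grad f) (G := grad f) h1 h1, dot_comm (η x),
    dot_comm (grad f x)] at h
  have e1 : dot (fun l => pd w (fun y => η y l) x) (η x)
      = mv (fun a b => pd a (fun y => η y b) x) (η x) w := rfl
  have e2 : dot (fun l => pd w (fun y => grad f y l) x) (grad f x)
      = mv (hess f x) (grad f x) w := rfl
  rw [e1, e2] at h
  linarith

/-- The hypotheses of the pointwise criterion `symm_iff` arise by differentiating the identities for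
`η`, which hold on an open set. No closedness is presupposed, so the equivalence serves both
directions of the theorem. -/
theorem pd_symm_iff {η : E3 → Vec} (hU : IsOpen U) (hf : ContDiffOn ℝ ∞ f U)
    (hη : ∀ i, ∀ y ∈ U, DifferentiableAt ℝ (fun y => η y i) y)
    (hperp : ∀ y ∈ U, dot (grad f y) (η y) = 0)
    (hlen : ∀ y ∈ U, dot (η y) (η y) = dot (grad f y) (grad f y))
    (hR : ∀ y ∈ U, jetR (grad f y) (hess f y) (η y) = 0) (hx : x ∈ U)
    (hJ : dot (grad f x) (grad f x) ≠ 0) (hZ : jetZ (grad f x) (hess f x) ≠ 0) :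
    (∀ i j, pd i (fun y => η y j) x = pd j (fun y => η y i) x) ↔
      jetV (grad f x) (hess f x) (third f x) = 0 ∧
      jetE (grad f x) (hess f x) (third f x) = 0 := by
  have h1 (i : Fin 3) := differentiableAt_of_contDiffOn hU (contDiffOn_d1 hU hf i) hx
  have h2 (i j : Fin 3) := differentiableAt_of_contDiffOn hU (contDiffOn_d2 hU hf i j) hx
  have hs := hess_symm hU hf hx
  refine symm_iff (m := fun a b => pd a (fun y => η y b) x)
    (c := fun a => pd a (fun y => dot (mv (hess f y) (grad f y)) (η y)) x)
    hJ (hperp x hx) (hlen x hx) hs (third_symm12 hU hf hx) (third_symm23 hU hf hx) (hR x hx) hZ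
    (mv_pd_add_mv_hess hU hf hη hperp hx) (mv_pd_eq_mv_hess hU hf hη hlen hx) ?_
  funext w i
  rw [← pd_jetR h1 h2 hs fun i => hη i x hx]
  exact pd_eq_zero hU hx fun y hy => congrFun (hR y hy) i

end Closedness

/-! ### Conjugate functions and closed 1-forms -/

theorem gradient_apply (h : E3 → ℝ) (x : E3) (i : Fin 3) : gradient h x i = pd i h x := by
  have h1 : inner ℝ (gradient h x) (EuclideanSpace.single i (1 : ℝ)) = pd i h x := by
    rw [gradient, InnerProductSpace.toDual_symm_apply]
    rfl
  rw [← h1, EuclideanSpace.inner_single_right]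
  simp

theorem inner_gradient (f g : E3 → ℝ) (x : E3) :
    inner ℝ (gradient f x) (gradient g x) = dot (grad f x) (grad g x) := by
  rw [PiLp.inner_apply, dot]
  refine Finset.sum_congr rfl fun i _ => ?_
  rw [gradient_apply, gradient_apply, mul_comm]
  rfl

theorem isConjugateOn_iff (f g : E3 → ℝ) (W : Set E3) :
    IsConjugateOn f g W ↔ ∀ x ∈ W, dot (grad g x) (grad g x) = dot (grad f x) (grad f x) ∧
      dot (grad f x) (grad g x) = 0 := by
  refine forall₂_congr fun x _ => and_congr ?_ ?_
  · rw [← inner_gradient, ← inner_gradient, real_inner_self_eq_norm_sq,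
      real_inner_self_eq_norm_sq, sq_eq_sq₀ (norm_nonneg _) (norm_nonneg _)]
    exact eq_comm
  · rw [inner_gradient]

/-- Pair `h1` with `w` and move the symmetric `m` across: `w · m v = m w · v = H v · v`. -/
theorem dot_add_jetB_eq_zero {v w : Vec} {H m : Ten2} (hm : ∀ i j, m i j = m j i)
    (h1 : mv m v + mv H w = 0) (h2 : mv m w = mv H v) : dot (mv H w) w + jetB v H = 0 := by
  have k1 : dot w (mv m v + mv H w) = 0 := by
    rw [h1]
    simp [dot]
  have k2 : dot w (mv m v) = dot (mv m w) v := by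
    simp only [dot, mv, Finset.sum_mul, Finset.mul_sum]
    rw [Finset.sum_comm]
    refine Finset.sum_congr rfl fun i _ => Finset.sum_congr rfl fun j _ => ?_
    rw [hm j i]
    ring
  rw [dot_add_right, k2, h2, dot_comm w] at k1
  rw [jetB]
  linarith

/-- `Y = Z²` when `X = 0`, and `Z` vanishes at critical points of `f`. -/
theorem dot_grad_ne_zero {f : E3 → ℝ} {x : E3} (hX : invX f x = 0) (hY : 0 < invY f x) :
    dot (grad f x) (grad f x) ≠ 0 := by
  intro h
  have h0 := dot_self_eq_zero.mp h
  rw [invY, hX, invZ_eq, h0] at hY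
  simp [jetZ, jetB, dot] at hY

theorem jetZ_ne_zero {f : E3 → ℝ} {x : E3} (hX : invX f x = 0) (hY : 0 < invY f x) :
    jetZ (grad f x) (hess f x) ≠ 0 := by
  intro h
  rw [invY, hX, invZ_eq, h] at hY
  simp at hY

theorem jet_eq_zero_of_isConjugateOn {f g : E3 → ℝ} {W : Set E3} (hW : IsOpen W)
    (hf : ContDiffOn ℝ ∞ f W) (hg : ContDiffOn ℝ ∞ g W) (hfg : IsConjugateOn f g W)
    (hX : ∀ x ∈ W, invX f x = 0) (hY : ∀ x ∈ W, 0 < invY f x) {x : E3} (hx : x ∈ W) :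
    jetV (grad f x) (hess f x) (third f x) = 0 ∧ jetE (grad f x) (hess f x) (third f x) = 0 := by
  rw [isConjugateOn_iff] at hfg
  have hη (i : Fin 3) (y : E3) (hy : y ∈ W) : DifferentiableAt ℝ (fun y => grad g y i) y :=
    differentiableAt_of_contDiffOn hW (contDiffOn_d1 hW hg i) hy
  have hperp (y : E3) (hy : y ∈ W) := (hfg y hy).2
  have hlen (y : E3) (hy : y ∈ W) := (hfg y hy).1
  refine (pd_symm_iff hW hf hη hperp hlen (fun y hy => ?_) hx
    (dot_grad_ne_zero (hX x hx) (hY x hx)) (jetZ_ne_zero (hX x hx) (hY x hx))).mp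
    fun i j => hess_symm hW hg hx i j
  exact jetR_eq_zero (dot_grad_ne_zero (hX y hy) (hY y hy)) (hperp y hy) (hlen y hy)
    (hess_symm hW hf hy) (hX y hy) (dot_add_jetB_eq_zero (hess_symm hW hg hy)
      (mv_pd_add_mv_hess hW hf hη hperp hy) (mv_pd_eq_mv_hess hW hf hη hlen hy))

/-- The Poincaré lemma for 1-forms on a convex open set, with the form regarded as a map `L` into
the dual space: symmetry of `fderiv ℝ L` is the symmetry of the partial derivatives of `η`. -/
theorem exists_primitive {η : E3 → Vec} {W : Set E3} (hW : IsOpen W) (hc : Convex ℝ W)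
    (hη : ∀ i, ContDiffOn ℝ ∞ (fun y => η y i) W)
    (hs : ∀ x ∈ W, ∀ i j, pd i (fun y => η y j) x = pd j (fun y => η y i) x) :
    ∃ g : E3 → ℝ, ContDiffOn ℝ ∞ g W ∧ ∀ x ∈ W, grad g x = η x := by
  set L : E3 → E3 →L[ℝ] ℝ := fun x => ∑ i, η x i • EuclideanSpace.proj i with hL
  have hLc : ContDiffOn ℝ ∞ L W :=
    ContDiffOn.sum fun i _ => (hη i).smul contDiffOn_const
  have hLd : DifferentiableOn ℝ L W := hLc.differentiableOn (by simp)
  have happ (x v : E3) : L x v = ∑ i, η x i * v i := by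
    simp [hL]
  have hfd (x : E3) (hx : x ∈ W) (u v : E3) :
      fderiv ℝ L x u v = ∑ i, ∑ j, u j * pd j (fun y => η y i) x * v i := by
    have hd (i : Fin 3) := differentiableAt_of_contDiffOn hW (hη i) hx
    have h1 : fderiv ℝ L x u v = fderiv ℝ (fun y => L y v) x u := by
      rw [fderiv_clm_apply (hLd.differentiableAt (hW.mem_nhds hx)) (by fun_prop)]
      simp
    have h2 : (fun y => L y v) = fun y => ∑ i, η y i * v i := funext fun y => happ y v
    rw [h1, h2, fderiv_fun_sum fun i _ => (hd i).mul_const _]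
    simp only [sum_apply]
    refine Finset.sum_congr rfl fun i _ => ?_
    rw [fderiv_mul_const (hd i), smul_apply, fderiv_apply_eq_sum, smul_eq_mul,
      mul_comm, Finset.sum_mul]
  obtain ⟨g, hg⟩ := hc.exists_forall_hasFDerivAt_of_fderiv_symmetric hW hLd fun x hx u v => by
    rw [hfd x hx, hfd x hx, Finset.sum_comm]
    refine Finset.sum_congr rfl fun i _ => Finset.sum_congr rfl fun j _ => ?_
    rw [hs x hx]
    ring
  refine ⟨g, ?_, fun x hx => ?_⟩
  -- The primitive is smooth because its derivative is the smooth map `L`.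
  · rw [contDiffOn_infty_iff_fderiv_of_isOpen hW]
    exact ⟨fun x hx => (hg x hx).differentiableAt.differentiableWithinAt,
      hLc.congr fun x hx => (hg x hx).fderiv⟩
  · funext i
    rw [grad, d1, pd, (hg x hx).fderiv, happ]
    simp

section Smoothness

variable {p : E3}

theorem contDiffAt_dot {F G : E3 → Vec} (hF : ∀ l, ContDiffAt ℝ ∞ (fun y => F y l) p)
    (hG : ∀ l, ContDiffAt ℝ ∞ (fun y => G y l) p) :
    ContDiffAt ℝ ∞ (fun y => dot (F y) (G y)) p :=
  ContDiffAt.sum fun l _ => (hF l).mul (hG l)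

theorem contDiffAt_jetM {F : E3 → Vec} {K : E3 → Ten2} (u : Vec)
    (hF : ∀ l, ContDiffAt ℝ ∞ (fun y => F y l) p)
    (hK : ∀ l n, ContDiffAt ℝ ∞ (fun y => K y l n) p) (i : Fin 3) :
    ContDiffAt ℝ ∞ (fun y => jetM (F y) (K y) u i) p := by
  have hJ := contDiffAt_dot hF hF
  have hu := contDiffAt_dot hF (G := fun _ => u) fun _ => contDiffAt_const
  have hw (l : Fin 3) : ContDiffAt ℝ ∞
      (fun y => (dot (F y) (F y) • u - dot (F y) u • F y) l) p :=
    (hJ.mul contDiffAt_const).sub (hu.mul (hF l))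
  have hm (l : Fin 3) := contDiffAt_dot (hK l) hw
  have hB := contDiffAt_dot (fun l => contDiffAt_dot (hK l) hF) hF
  exact ((hJ.mul (hm i)).sub ((contDiffAt_dot hF hm).mul (hF i))).add (hB.mul (hw i))

theorem contDiffAt_jetOmega {F : E3 → Vec} {K : E3 → Ten2} (u : Vec)
    (hF : ∀ l, ContDiffAt ℝ ∞ (fun y => F y l) p)
    (hK : ∀ l n, ContDiffAt ℝ ∞ (fun y => K y l n) p) (h0 : jetM (F p) (K p) u ≠ 0)
    (i : Fin 3) : ContDiffAt ℝ ∞ (fun y => jetOmega (F y) (K y) u i) p := by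
  have hm := contDiffAt_jetM u hF hK
  have hmm := contDiffAt_dot hm hm
  have hpos : 0 < dot (jetM (F p) (K p) u) (jetM (F p) (K p) u) :=
    lt_of_le_of_ne (dot_self_nonneg _) fun h => h0 (dot_self_eq_zero.mp h.symm)
  have hc : ContDiffAt ℝ ∞ (fun y => cross (F y) (jetM (F y) (K y) u) i) p := by
    fin_cases i
    · exact ((hF 1).mul (hm 2)).sub ((hF 2).mul (hm 1))
    · exact ((hF 2).mul (hm 0)).sub ((hF 0).mul (hm 2))
    · exact ((hF 0).mul (hm 1)).sub ((hF 1).mul (hm 0))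
  exact ((hmm.sqrt hpos.ne').inv (Real.sqrt_pos.mpr hpos).ne').mul hc

end Smoothness

theorem exists_conjugate_of_jet_eq_zero {f : E3 → ℝ} {U : Set E3} (hU : IsOpen U)
    (hf : ContDiffOn ℝ ∞ f U) (hX : ∀ x ∈ U, invX f x = 0) (hY : ∀ x ∈ U, 0 < invY f x)
    (hj : ∀ x ∈ U, jetV (grad f x) (hess f x) (third f x) = 0 ∧
      jetE (grad f x) (hess f x) (third f x) = 0) {p : E3} (hp : p ∈ U) :
    ∃ W : Set E3, IsOpen W ∧ p ∈ W ∧ W ⊆ U ∧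
      ∃ g : E3 → ℝ, ContDiffOn ℝ ∞ g W ∧ IsConjugateOn f g W := by
  have hF (x : E3) (hx : x ∈ U) (l : Fin 3) : ContDiffAt ℝ ∞ (fun y => grad f y l) x :=
    (contDiffOn_d1 hU hf l).contDiffAt (hU.mem_nhds hx)
  have hK (x : E3) (hx : x ∈ U) (l n : Fin 3) : ContDiffAt ℝ ∞ (fun y => hess f y l n) x :=
    (contDiffOn_d2 hU hf l n).contDiffAt (hU.mem_nhds hx)
  obtain ⟨k, hk⟩ := exists_jetM_ne_zero (dot_grad_ne_zero (hX p hp) (hY p hp))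
    (jetZ_ne_zero (hX p hp) (hY p hp))
  -- A basis vector that works at `p` works nearby by continuity. Keeping it fixed makes `jetOmega`
  -- smooth, with a consistent choice of sign; a ball is taken for convexity.
  have hev : ∀ᶠ x in nhds p, x ∈ U ∧ jetM (grad f x) (hess f x) (kron k) ≠ 0 := by
    refine (hU.eventually_mem hp).and ?_
    have hcont : ContinuousAt (fun x => jetM (grad f x) (hess f x) (kron k)) p :=
      continuousAt_pi.mpr fun i => (contDiffAt_jetM _ (hF p hp) (hK p hp) i).continuousAt
    exact hcont.eventually_ne hk
  obtain ⟨ε, hε, hball⟩ := Metric.eventually_nhds_iff_ball.mp hev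
  have hWU : Metric.ball p ε ⊆ U := fun x hx => (hball x hx).1
  have hη (i : Fin 3) : ContDiffOn ℝ ∞ (fun y => jetOmega (grad f y) (hess f y) (kron k) i)
      (Metric.ball p ε) := fun x hx =>
    (contDiffAt_jetOmega _ (hF x (hWU hx)) (hK x (hWU hx)) (hball x hx).2 i).contDiffWithinAt
  have hperp (y : E3) (_ : y ∈ Metric.ball p ε) := dot_jetOmega (grad f y) (hess f y) (kron k)
  have hlen (y : E3) (hy : y ∈ Metric.ball p ε) := dot_jetOmega_self (hball y hy).2
  obtain ⟨g, hg, hgrad⟩ := exists_primitive Metric.isOpen_ball (convex_ball p ε) hη fun x hx => by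
    refine (pd_symm_iff Metric.isOpen_ball (hf.mono hWU)
      (fun i y hy => differentiableAt_of_contDiffOn Metric.isOpen_ball (hη i) hy) hperp hlen
      (fun y hy => ?_) hx (dot_grad_ne_zero (hX x (hWU hx)) (hY x (hWU hx)))
      (jetZ_ne_zero (hX x (hWU hx)) (hY x (hWU hx)))).mpr (hj x (hWU hx))
    exact jetR_jetOmega (dot_grad_ne_zero (hX y (hWU hy)) (hY y (hWU hy)))
      (hess_symm hU hf (hWU hy)) (hX y (hWU hy)) (hball y hy).2
  refine ⟨Metric.ball p ε, Metric.isOpen_ball, Metric.mem_ball_self hε, hWU, g, hg, ?_⟩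
  rw [isConjugateOn_iff]
  intro x hx
  rw [hgrad x hx]
  exact ⟨hlen x hx, hperp x hx⟩

/-! ### The equivalence -/

theorem locallyAdmitsSmoothConjugate_iff {U : Set E3} (hU : IsOpen U)
    {f : E3 → ℝ} (hf : ContDiffOn ℝ ∞ f U)
    (hX : ∀ x ∈ U, invX f x = 0)
    (hY : ∀ x ∈ U, 0 < invY f x) :
    LocallyAdmitsSmoothConjugate f U ↔
      (∀ x ∈ U, invV f x = 0) ∧
      (∀ x ∈ U,
        25 / 14 * invN f x
          + 3 / 5 * invG f x
          + 3 / 4 * invF f x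
          + 1 / 21 * invT f x
          - 17 / 21 * (invZ f x * invK f x)
          - 7 / 9 * (invZ f x * invA f x) = 0) := by
  have hV (x : E3) (hx : x ∈ U) : invV f x = jetV (grad f x) (hess f x) (third f x) :=
    invV_eq (hess_symm hU hf hx) (third_symm12 hU hf hx)
  have hE (x : E3) (hx : x ∈ U) := evenInvariant_eq
    (fun i => differentiableAt_of_contDiffOn hU (contDiffOn_d1 hU hf i) hx)
    (fun i j => differentiableAt_of_contDiffOn hU (contDiffOn_d2 hU hf i j) hx)
    (hess_symm hU hf hx)
  constructor
  · intro h
    have key (x : E3) (hx : x ∈ U) : jetV (grad f x) (hess f x) (third f x) = 0 ∧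
        jetE (grad f x) (hess f x) (third f x) = 0 := by
      obtain ⟨W, hW, hxW, hWU, g, hg, hfg⟩ := h x hx
      exact jet_eq_zero_of_isConjugateOn hW (hf.mono hWU) hg hfg (fun y hy => hX y (hWU hy))
        (fun y hy => hY y (hWU hy)) hxW
    exact ⟨fun x hx => (hV x hx).trans (key x hx).1, fun x hx => (hE x hx).trans (key x hx).2⟩
  · rintro ⟨h1, h2⟩ p hp
    exact exists_conjugate_of_jet_eq_zero hU hf hX hY
      (fun x hx => ⟨(hV x hx).symm.trans (h1 x hx), (hE x hx).symm.trans (h2 x hx)⟩) hp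

end ConjugateFunctions

end

theorem mainTheorem6 (U : Set ConjugateFunctions.E3) (hU : IsOpen U)
    (f : ConjugateFunctions.E3 → ℝ) (hf : ContDiffOn ℝ ∞ f U)
    (hX : ∀ x ∈ U, ConjugateFunctions.invX f x = 0)
    (hY : ∀ x ∈ U, 0 < ConjugateFunctions.invY f x) :
    ConjugateFunctions.LocallyAdmitsSmoothConjugate f U ↔
      (∀ x ∈ U, ConjugateFunctions.invV f x = 0) ∧
      (∀ x ∈ U,
        25 / 14 * ConjugateFunctions.invN f x
          + 3 / 5 * ConjugateFunctions.invG f x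
          + 3 / 4 * ConjugateFunctions.invF f x
          + 1 / 21 * ConjugateFunctions.invT f x
          - 17 / 21 * (ConjugateFunctions.invZ f x * ConjugateFunctions.invK f x)
          - 7 / 9 * (ConjugateFunctions.invZ f x * ConjugateFunctions.invA f x) = 0) :=
  ConjugateFunctions.locallyAdmitsSmoothConjugate_iff hU hf hX hY
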